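/- Let $\mathbf k$ be a field of arbitrary characteristic; algebras are associative, not necessarily unital, $\mathbf k$-algebras, and $\otimes=\otimes_{\mathbf k}$. For an algebra $B$ consider the first quadrant bicomplex whose column $p$ is $B^{\otimes(q+1)}$, $q\ge 0$, with vertical differential $b$ for $p$ even and $-b'$ for $p$ odd, where $$b'(a_0\otimes\cdots\otimes a_n)=\sum_{i=0}^{n-1}(-1)^i a_0\otimes\cdots\otimes a_ia_{i+1}\otimes\cdots\otimes a_n,\qquad b(a_0\otimes\cdots\otimes a_n)=b'(a_0\otimes\cdots\otimes a_n)+(-1)^n a_na_0\otimes a_1\otimes\cdots\otimes a_{n-1},$$ and whose horizontal differentials are alternately $1-t$ (from odd to even columns) and $N$ (from even to odd columns), where $t(a_0\otimes\cdots\otimes a_n)=(-1)^n a_n\otimes a_0\otimes\cdots\otimes a_{n-1}$ and $N=1+t+\cdots+t^n$. Let $CC(B)$ be its total complex, $CC^{\{2\}}(B)$ the total complex of its first two columns ($p=0,1$), and put $HC_n(B)=H_n(CC(B))$, $HH_n(B)=H_n(CC^{\{2\}}(B))$. A crossed module $(R,A,\rho)$ of algebras is an algebra homomorphism $\rho:R\to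 A$ together with an $A$-bimodule structure on $R$ with $a(rr')=(ar)r'$, $(ra)r'=r(ar')$, $(rr')a=r(r'a)$, such that $\rho(ar)=a\rho(r)$, $\rho(ra)=\rho(r)a$ and $\rho(r)r'=rr'=r\rho(r')$. Its nerve $\mathfrak N_*(R,A,\rho)$ is the simplicial algebra with $\mathfrak N_n=R\rtimes(\cdots(R\rtimes A)\cdots)$ ($n$ factors $R$), the nerve of the internal category with objects $A$ and arrows $R\rtimes A$, where $(r,a)$ has source $a$ and target $\rho(r)+a$; its faces are $$d_0(r_1,\dots,r_n,a)=(r_2,\dots,r_n,a),\quad d_i(r_1,\dots,r_n,a)=(r_1,\dots,r_i+r_{i+1},\dots,r_n,a)\ (0<i<n),\quad d_n(r_1,\dots,r_n,a)=(r_1,\dots,r_{n-1},\rho(r_n)+a),$$ and $s_i$ inserts a $0$ after $r_i$. For $\Phi=CC^{\{2\}}$ or $CC$ let $\Phi(R,A,\rho)$ be the total complex of the bicomplex with columns $\Phi(\mathfrak N_p(R,A,\rho))$, $p\ge0$ (vertical differential multiplied by $(-1)^p$), and horizontal differentials the alternating sums of the maps induced by the faces. Put $HH_n(R,A,\rho)=H_n(CC^{\{2\}}(R,A,\rho))$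 and $HC_n(R,A,\rho)=H_n(CC(R,A,\rho))$. The projection $\mathfrak N_0=A\to\operatorname{Coker}\rho=A/\rho(R)$ induces natural maps $HH_n(R,A,\rho)\to HH_n(\operatorname{Coker}\rho)$ and $HC_n(R,A,\rho)\to HC_n(\operatorname{Coker}\rho)$. Let $[A,\operatorname{Ker}\rho]$ be the subspace of $\operatorname{Ker}\rho$ spanned by all $ax-xa$ with $a\in A$, $x\in\operatorname{Ker}\rho$. **Theorem.** Let $(R,A,\rho)$ be a crossed module of algebras. There are exact sequences of vector spaces $$HH_2(R,A,\rho)\to HH_2(\operatorname{Coker}\rho)\to \operatorname{Ker}\rho/[A,\operatorname{Ker}\rho]\to HH_1(R,A,\rho)\to HH_1(\operatorname{Coker}\rho)\to 0,$$ $$HC_2(R,A,\rho)\to HC_2(\operatorname{Coker}\rho)\to \operatorname{Ker}\rho/[A,\operatorname{Ker}\rho]\to HC_1(R,A,\rho)\to HC_1(\operatorname{Coker}\rho)\to 0,$$ in which the maps $HH_n(R,A,\rho)\to HH_n(\operatorname{Coker}\rho)$ and $HC_n(R,A,\rho)\to HC_n(\operatorname{Coker}\rho)$, $n=1,2$, are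 the natural ones, and the map from $\operatorname{Ker}\rho/[A,\operatorname{Ker}\rho]$ sends the class of $x$ to the homology class of the cycle $(x,0)\in\mathfrak N_1(R,A,\rho)$. Moreover $$HH_0(R,A,\rho)=HC_0(R,A,\rho)=\operatorname{Coker}\rho/[\operatorname{Coker}\rho,\operatorname{Coker}\rho],$$ the class of $a\in A=\mathfrak N_0(R,A,\rho)$ corresponding to the class of $a$. -/

import Mathlib

open CategoryTheory

universe u v

namespace AlgHomology

noncomputable section

open scoped TensorProduct ZeroObject

section Hochschild

variable (k : Type u) [Field k] (A : Type v) [NonUnitalRing A] [Module k A]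
  [IsScalarTower k A A] [SMulCommClass k A A]

/-- The space `A^{⊗(n+1)}` of Hochschild (or bar) `n`-chains. -/
abbrev HochschildChains (n : ℕ) : Type (max u v) := ⨂[k] (_ : Fin (n + 1)), A

variable {A} in
theorem contractNth_update {n : ℕ} (i : Fin (n + 1)) (g : Fin (n + 2) → A) (p : Fin (n + 2)) :
    ∃ (j : Fin (n + 1)) (L : A →ₗ[k] A), ∀ x : A,
      i.castSucc.contractNth (· * ·) (Function.update g p x) =
        Function.update (i.castSucc.contractNth (· * ·) g) j (L x) := by
  rcases lt_trichotomy p.val i.val with h | h | h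
  · refine ⟨⟨p, by omega⟩, LinearMap.id, fun x => funext fun j => ?_⟩
    simp only [Fin.contractNth, Function.update_apply, Fin.ext_iff, Fin.val_castSucc, Fin.val_succ]
    grind [LinearMap.id_apply]
  · refine ⟨⟨p, by omega⟩, LinearMap.mulRight k (g i.succ), fun x => funext fun j => ?_⟩
    simp only [Fin.contractNth, Function.update_apply, Fin.ext_iff, Fin.val_castSucc, Fin.val_succ,
      LinearMap.mulRight_apply]
    have : j.val = i.val → j = i := fun h => Fin.ext h
    grind
  · by_cases h' : p.val = i.val + 1
    · refine ⟨i, LinearMap.mulLeft k (g i.castSucc), fun x => funext fun j => ?_⟩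
      simp only [Fin.contractNth, Function.update_apply, Fin.ext_iff, Fin.val_castSucc,
        Fin.val_succ, LinearMap.mulLeft_apply]
      have : j.val = i.val → j = i := fun h => Fin.ext h
      grind
    · refine ⟨⟨p - 1, by omega⟩, LinearMap.id, fun x => funext fun j => ?_⟩
      simp only [Fin.contractNth, Function.update_apply, Fin.ext_iff, Fin.val_castSucc,
        Fin.val_succ]
      grind [LinearMap.id_apply]

/-- `a₀ ⊗ ⋯ ⊗ aₙ₊₁ ↦ a₀ ⊗ ⋯ ⊗ aᵢaᵢ₊₁ ⊗ ⋯ ⊗ aₙ₊₁`, for `0 ≤ i ≤ n`. -/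
def mulAt (n : ℕ) (i : Fin (n + 1)) : HochschildChains k A (n + 1) →ₗ[k] HochschildChains k A n :=
  PiTensorProduct.lift
    { toFun := fun g => PiTensorProduct.tprod k (i.castSucc.contractNth (· * ·) g)
      map_update_add' := fun {inst} g p x y => by
        obtain rfl : inst = instDecidableEqFin _ := Subsingleton.elim _ _
        obtain ⟨j, L, h⟩ := contractNth_update k i g p
        simp only [h, map_add, MultilinearMap.map_update_add]
      map_update_smul' := fun {inst} g p c x => by
        obtain rfl : inst = instDecidableEqFin _ := Subsingleton.elim _ _
        obtain ⟨j, L, h⟩ := contractNth_update k i g p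
        simp only [h, map_smul, MultilinearMap.map_update_smul] }

/-- `a₀ ⊗ ⋯ ⊗ aₙ ↦ aₙ ⊗ a₀ ⊗ ⋯ ⊗ aₙ₋₁`. -/
def rotate (n : ℕ) : HochschildChains k A n →ₗ[k] HochschildChains k A n :=
  (PiTensorProduct.reindex k (fun _ => A) (finRotate (n + 1))).toLinearMap

/-- The bar differential `b'`, an alternating sum of `n + 1` terms. -/
def barD (n : ℕ) : HochschildChains k A (n + 1) →ₗ[k] HochschildChains k A n :=
  ∑ i : Fin (n + 1), (-1 : k) ^ (i : ℕ) • mulAt k A n i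

/-- The Hochschild differential `b`: besides `b'` it has the term
`(-1)ⁿ⁺¹ aₙ₊₁a₀ ⊗ a₁ ⊗ ⋯ ⊗ aₙ`. -/
def hochschildD (n : ℕ) : HochschildChains k A (n + 1) →ₗ[k] HochschildChains k A n :=
  barD k A n + (-1 : k) ^ (n + 1) • (mulAt k A n 0 ∘ₗ rotate k A (n + 1))

/-- The signed cyclic operator `t`. -/
def cyclicT (n : ℕ) : HochschildChains k A n →ₗ[k] HochschildChains k A n :=
  (-1 : k) ^ n • rotate k A n

/-- The norm operator `N = 1 + t + ⋯ + tⁿ`. -/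
def cyclicNorm (n : ℕ) : HochschildChains k A n →ₗ[k] HochschildChains k A n :=
  ∑ i ∈ Finset.range (n + 1), cyclicT k A n ^ i

variable {k A}

theorem mulAt_tprod (n : ℕ) (i : Fin (n + 1)) (g : Fin (n + 2) → A) :
    mulAt k A n i (PiTensorProduct.tprod k g) =
      PiTensorProduct.tprod k (i.castSucc.contractNth (· * ·) g) := by
  simp [mulAt]

set_option linter.unusedSectionVars false in
theorem rotate_tprod (n : ℕ) (g : Fin (n + 1) → A) :
    rotate k A n (PiTensorProduct.tprod k g) =
      PiTensorProduct.tprod k (fun j => g ((finRotate (n + 1)).symm j)) := by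
  simp [rotate]

theorem finRotate_symm_val (n : ℕ) (j : Fin (n + 1)) :
    ((finRotate (n + 1)).symm j).val = if j.val = 0 then n else j.val - 1 := by
  obtain ⟨i, rfl⟩ := (finRotate (n + 1)).surjective j
  rw [Equiv.symm_apply_apply, coe_finRotate]
  have := i.2
  simp only [Fin.ext_iff, Fin.val_last]
  split_ifs <;> grind

variable (k A)


theorem finset_sum_comp {ι M₁ M₂ M₃ : Type*} [AddCommGroup M₁] [AddCommGroup M₂] [AddCommGroup M₃]
    [Module k M₁] [Module k M₂] [Module k M₃] (s : Finset ι) (f : ι → M₂ →ₗ[k] M₃)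
    (g : M₁ →ₗ[k] M₂) : (∑ i ∈ s, f i) ∘ₗ g = ∑ i ∈ s, f i ∘ₗ g := by
  ext; simp

theorem comp_finset_sum {ι M₁ M₂ M₃ : Type*} [AddCommGroup M₁] [AddCommGroup M₂] [AddCommGroup M₃]
    [Module k M₁] [Module k M₂] [Module k M₃] (s : Finset ι) (f : ι → M₁ →ₗ[k] M₂)
    (g : M₂ →ₗ[k] M₃) : (g ∘ₗ ∑ i ∈ s, f i) = ∑ i ∈ s, g ∘ₗ f i := by
  ext; simp

theorem exists_nat_extension {X : Type*} {n : ℕ} (g : Fin (n + 1) → X) :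
    ∃ G : ℕ → X, g = fun i => G i.val :=
  ⟨fun i => if h : i < n + 1 then g ⟨i, h⟩ else g 0, by
    funext i
    have := i.2
    simp only [this, dif_pos]⟩

theorem mulAt_comp_rotate (n : ℕ) (i : Fin n) :
    mulAt k A n i.succ ∘ₗ rotate k A (n + 1) = rotate k A n ∘ₗ mulAt k A n i.castSucc := by
  refine PiTensorProduct.ext (MultilinearMap.ext fun g => ?_)
  obtain ⟨G, rfl⟩ := exists_nat_extension g
  simp only [LinearMap.compMultilinearMap_apply, LinearMap.comp_apply, mulAt_tprod, rotate_tprod]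
  congr 1
  funext j
  have := i.2
  have := j.2
  simp only [Fin.contractNth, Fin.val_castSucc, Fin.val_succ, finRotate_symm_val]
  grind

theorem mulAt_zero_rotate_rotate (n : ℕ) :
    mulAt k A n 0 ∘ₗ rotate k A (n + 1) ∘ₗ rotate k A (n + 1) =
      rotate k A n ∘ₗ mulAt k A n (Fin.last n) := by
  refine PiTensorProduct.ext (MultilinearMap.ext fun g => ?_)
  obtain ⟨G, rfl⟩ := exists_nat_extension g
  simp only [LinearMap.compMultilinearMap_apply, LinearMap.comp_apply, mulAt_tprod, rotate_tprod]
  congr 1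
  funext j
  have := j.2
  simp only [Fin.contractNth, Fin.val_castSucc, Fin.val_succ, finRotate_symm_val, Fin.val_zero,
    Fin.val_last]
  grind

theorem mulAt_comp_mulAt (n : ℕ) (i j : Fin (n + 1)) (h : i ≤ j) :
    mulAt k A n i ∘ₗ mulAt k A (n + 1) j.succ = mulAt k A n j ∘ₗ mulAt k A (n + 1) i.castSucc := by
  refine PiTensorProduct.ext (MultilinearMap.ext fun g => ?_)
  simp only [LinearMap.compMultilinearMap_apply, LinearMap.comp_apply, mulAt_tprod]
  congr 1
  funext l
  rw [Fin.le_def] at h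
  simp only [Fin.contractNth, Fin.val_castSucc, Fin.val_succ]
  have := mul_assoc (g l.castSucc.castSucc) (g l.castSucc.succ) (g l.succ.succ)
  grind

theorem rotate_pow (n : ℕ) : rotate k A n ^ (n + 1) = 1 := by
  have h1 : ∀ (m : ℕ) (g : Fin (n + 1) → A), (rotate k A n ^ m) (PiTensorProduct.tprod k g) =
      PiTensorProduct.tprod k (fun j => g (((finRotate (n + 1)).symm ^ m) j)) := by
    intro m
    induction m with
    | zero => intro g; simp
    | succ m ih =>
      intro g
      rw [pow_succ, Module.End.mul_apply, rotate_tprod, ih, pow_succ']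
      rfl
  have h2 : (finRotate (n + 1)) ^ (n + 1) = 1 := by
    rcases n with _ | n
    · ext i; omega
    · have h := (isCycle_finRotate (n := n)).orderOf
      rw [support_finRotate, Finset.card_univ, Fintype.card_fin] at h
      have h' := pow_orderOf_eq_one (finRotate (n + 2))
      rwa [h] at h'
  have h3 : (finRotate (n + 1)).symm ^ (n + 1) = 1 := by
    change (finRotate (n + 1))⁻¹ ^ (n + 1) = 1
    rw [inv_pow, h2, inv_one]
  refine PiTensorProduct.ext (MultilinearMap.ext fun g => ?_)
  simp only [LinearMap.compMultilinearMap_apply, h1, h3]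
  rfl

theorem cyclicT_pow (n : ℕ) : cyclicT k A n ^ (n + 1) = 1 := by
  rw [cyclicT, smul_pow, rotate_pow, ← pow_mul, Even.neg_one_pow (Nat.even_mul_succ_self n),
    one_smul]

theorem mulAt_comp_cyclicT (n : ℕ) (i : Fin n) :
    mulAt k A n i.succ ∘ₗ cyclicT k A (n + 1) = - (cyclicT k A n ∘ₗ mulAt k A n i.castSucc) := by
  simp only [cyclicT, LinearMap.comp_smul, LinearMap.smul_comp, mulAt_comp_rotate, pow_succ,
    mul_neg, mul_one]
  module

theorem mulAt_zero_cyclicT_cyclicT (n : ℕ) :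
    (mulAt k A n 0 ∘ₗ cyclicT k A (n + 1)) ∘ₗ cyclicT k A (n + 1) =
      (-1 : k) ^ n • (cyclicT k A n ∘ₗ mulAt k A n (Fin.last n)) := by
  have := mulAt_zero_rotate_rotate k A n
  simp only [cyclicT, LinearMap.comp_smul, LinearMap.smul_comp, LinearMap.comp_assoc, this,
    smul_smul]
  simp only [← pow_add]
  rw [Even.neg_one_pow ⟨n + 1, rfl⟩, Even.neg_one_pow ⟨n, rfl⟩]

theorem hochschildD_eq (n : ℕ) :
    hochschildD k A n = barD k A n + mulAt k A n 0 ∘ₗ cyclicT k A (n + 1) := by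
  simp only [hochschildD, cyclicT, LinearMap.comp_smul]

theorem barD_eq_zero_add (n : ℕ) : barD k A n = mulAt k A n 0 +
    ∑ i : Fin n, (-1 : k) ^ (i.val + 1) • mulAt k A n i.succ := by
  simp [barD, Fin.sum_univ_succ]

theorem barD_eq_add_last (n : ℕ) : barD k A n =
    ∑ i : Fin n, (-1 : k) ^ i.val • mulAt k A n i.castSucc +
      (-1 : k) ^ n • mulAt k A n (Fin.last n) := by
  simp [barD, Fin.sum_univ_castSucc]

theorem barD_comp_cyclicT (n : ℕ) : barD k A n ∘ₗ cyclicT k A (n + 1) =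
    mulAt k A n 0 ∘ₗ cyclicT k A (n + 1) +
      ∑ i : Fin n, (-1 : k) ^ i.val • (cyclicT k A n ∘ₗ mulAt k A n i.castSucc) := by
  rw [barD_eq_zero_add, LinearMap.add_comp, finset_sum_comp]
  congr 1
  refine Finset.sum_congr rfl fun i _ => ?_
  rw [LinearMap.smul_comp, mulAt_comp_cyclicT, pow_succ, mul_neg_one, neg_smul_neg]

/-- `b (1 - t) = (1 - t) b'`. -/
theorem hochschildD_comp_one_sub_cyclicT (n : ℕ) :
    hochschildD k A n ∘ₗ (LinearMap.id - cyclicT k A (n + 1)) =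
      (LinearMap.id - cyclicT k A n) ∘ₗ barD k A n := by
  have h : cyclicT k A n ∘ₗ barD k A n =
      ∑ i : Fin n, (-1 : k) ^ i.val • (cyclicT k A n ∘ₗ mulAt k A n i.castSucc) +
      (-1 : k) ^ n • (cyclicT k A n ∘ₗ mulAt k A n (Fin.last n)) := by
    rw [barD_eq_add_last, LinearMap.comp_add, LinearMap.comp_smul, comp_finset_sum]
    simp only [LinearMap.comp_smul]
  rw [LinearMap.comp_sub, LinearMap.sub_comp, LinearMap.comp_id, LinearMap.id_comp, h,
    hochschildD_eq, LinearMap.add_comp, barD_comp_cyclicT, mulAt_zero_cyclicT_cyclicT]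
  abel

theorem alternating_sum_eq_zero {M : Type*} [AddCommGroup M] [Module k M] (n : ℕ)
    (F : Fin (n + 1) → Fin (n + 2) → M) (h : ∀ i j, i ≤ j → F i j.succ = F j i.castSucc) :
    ∑ i : Fin (n + 1), ∑ j : Fin (n + 2), ((-1 : k) ^ i.val * (-1 : k) ^ j.val) • F i j = 0 := by
  rw [← Fintype.sum_prod_type' (fun (i : Fin (n + 1)) (j : Fin (n + 2)) =>
    ((-1 : k) ^ i.val * (-1 : k) ^ j.val) • F i j)]
  refine Finset.sum_ninvolution (fun p => if hp : p.1.val < p.2.val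
    then (⟨p.2.val - 1, by omega⟩, p.1.castSucc) else (⟨p.2.val, by omega⟩, p.1.succ)) ?_ ?_ ?_ ?_
  · rintro ⟨i, j⟩
    by_cases hij : i.val < j.val
    · obtain ⟨j, rfl⟩ : ∃ j' : Fin (n + 1), j = j'.succ := ⟨⟨j.val - 1, by omega⟩, by ext; simp; omega⟩
      simp only [Fin.val_succ] at hij
      have := h i j (Fin.le_def.2 (by omega))
      simp [this, hij, pow_succ, mul_comm]
    · obtain ⟨j, rfl⟩ : ∃ j' : Fin (n + 1), j = j'.castSucc := ⟨⟨j.val, by omega⟩, rfl⟩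
      simp only [Fin.val_castSucc] at hij
      have := h j i (Fin.le_def.2 (by omega))
      simp [this, hij, pow_succ, mul_comm]
  · rintro ⟨i, j⟩ - 
    grind
  · simp
  · rintro ⟨i, j⟩
    by_cases hij : i.val < j.val
    · have h1 : ¬ (j.val - 1 < i.val) := by omega
      simp only [hij, h1, dif_pos, dif_neg, Fin.val_castSucc, not_false_eq_true, Prod.mk.injEq,
        true_and, Fin.ext_iff, Fin.val_succ]
      omega
    · have h1 : j.val < i.val + 1 := by omega
      simp [hij, h1]

theorem barD_comp_barD (n : ℕ) : barD k A n ∘ₗ barD k A (n + 1) = 0 := by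
  rw [← alternating_sum_eq_zero k n (fun i j => mulAt k A n i ∘ₗ mulAt k A (n + 1) j)
    (mulAt_comp_mulAt k A n)]
  simp only [barD, finset_sum_comp, comp_finset_sum, LinearMap.comp_smul,
    LinearMap.smul_comp, smul_smul, Finset.smul_sum]
  rw [Finset.sum_comm]
  simp only [mul_comm]

theorem hochschildD_comp_hochschildD (n : ℕ) :
    hochschildD k A n ∘ₗ hochschildD k A (n + 1) = 0 := by
  have h1 := barD_comp_barD k A n
  have h2 := hochschildD_comp_one_sub_cyclicT k A (n + 1)
  have h3 := mulAt_comp_cyclicT k A (n + 1) 0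
  have h4 : barD k A n ∘ₗ mulAt k A (n + 1) 0 + mulAt k A n 0 ∘ₗ barD k A (n + 1) =
      mulAt k A n 0 ∘ₗ mulAt k A (n + 1) 0 := by
    rw [barD_eq_zero_add k A (n + 1), LinearMap.comp_add, comp_finset_sum, barD,
      finset_sum_comp]
    rw [add_left_comm, ← Finset.sum_add_distrib]
    simp only [LinearMap.smul_comp, LinearMap.comp_smul]
    rw [add_eq_left]
    refine Finset.sum_eq_zero fun i _ => ?_
    have := mulAt_comp_mulAt k A n 0 i (Fin.zero_le i)
    simp only [Fin.castSucc_zero] at this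
    rw [this, pow_succ, mul_neg_one]
    module
  have h5 := mulAt_comp_mulAt k A n 0 0 le_rfl
  simp only [Fin.castSucc_zero] at h3 h5
  rw [hochschildD_eq] at h2 ⊢
  rw [hochschildD_eq]
  refine LinearMap.ext fun x => ?_
  have e1 := fun x => LinearMap.congr_fun h1 x
  have e2 := LinearMap.congr_fun h2 x
  have e3 := LinearMap.congr_fun h3 (cyclicT k A (n + 2) x)
  have e4 := LinearMap.congr_fun h4 (cyclicT k A (n + 2) x)
  have e5 := LinearMap.congr_fun h5 (cyclicT k A (n + 2) (cyclicT k A (n + 2) x))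
  simp only [LinearMap.comp_apply, LinearMap.add_apply, LinearMap.sub_apply, LinearMap.neg_apply,
    LinearMap.id_apply, LinearMap.zero_apply, map_add, map_sub] at *
  have e2' := congrArg (mulAt k A n 0) e2
  have e3' := congrArg (mulAt k A n 0) e3
  simp only [map_add, map_sub, map_neg] at e2' e3'
  rw [e1 x]
  rw [e5] at e3'
  grind

theorem mulAt_comp_cyclicT_pow (n : ℕ) (i : Fin (n + 1)) :
    (-1 : k) ^ i.val • (mulAt k A n i ∘ₗ (cyclicT k A (n + 1) ^ i.val)) =
      (cyclicT k A n ^ i.val) ∘ₗ mulAt k A n 0 := by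
  obtain ⟨i, hi⟩ := i
  induction i with
  | zero => simp; rfl
  | succ i ih =>
    have h := mulAt_comp_cyclicT k A n ⟨i, by omega⟩
    simp only [Fin.succ_mk, Fin.castSucc_mk] at h
    have ih := ih (by omega)
    simp only at ih ⊢
    rw [pow_succ' (cyclicT k A (n + 1)), Module.End.mul_eq_comp, ← LinearMap.comp_assoc, h,
      pow_succ' (cyclicT k A n), Module.End.mul_eq_comp, LinearMap.comp_assoc, ← ih,
      LinearMap.neg_comp, pow_succ, mul_neg_one, neg_smul_neg, LinearMap.comp_smul,
      LinearMap.comp_assoc]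

theorem one_sub_cyclicT_comp_cyclicNorm (n : ℕ) :
    (LinearMap.id - cyclicT k A n) ∘ₗ cyclicNorm k A n = 0 := by
  have := mul_neg_geom_sum (cyclicT k A n) (n + 1)
  rw [cyclicT_pow, sub_self] at this
  exact this

theorem cyclicNorm_comp_one_sub_cyclicT (n : ℕ) :
    cyclicNorm k A n ∘ₗ (LinearMap.id - cyclicT k A n) = 0 := by
  have := geom_sum_mul_neg (cyclicT k A n) (n + 1)
  rw [cyclicT_pow, sub_self] at this
  exact this

theorem cyclicT_pow_comp_cyclicNorm (n i : ℕ) :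
    (cyclicT k A n ^ i) * cyclicNorm k A n = cyclicNorm k A n := by
  have h : cyclicT k A n * cyclicNorm k A n = cyclicNorm k A n := by
    have : (1 - cyclicT k A n) * cyclicNorm k A n = 0 := one_sub_cyclicT_comp_cyclicNorm k A n
    rw [sub_mul, one_mul, sub_eq_zero] at this
    exact this.symm
  induction i with
  | zero => simp
  | succ i ih => rw [pow_succ, mul_assoc, h, ih]

theorem cyclicNorm_comp_cyclicT_pow (n i : ℕ) :
    cyclicNorm k A n * (cyclicT k A n ^ i) = cyclicNorm k A n := by
  have h : cyclicNorm k A n * cyclicT k A n = cyclicNorm k A n := by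
    have : cyclicNorm k A n * (1 - cyclicT k A n) = 0 := cyclicNorm_comp_one_sub_cyclicT k A n
    rw [mul_sub, mul_one, sub_eq_zero] at this
    exact this.symm
  induction i with
  | zero => simp
  | succ i ih => rw [pow_succ', ← mul_assoc, h, ih]

/-- `b' N = N b`. -/
theorem barD_comp_cyclicNorm (n : ℕ) :
    barD k A n ∘ₗ cyclicNorm k A (n + 1) = cyclicNorm k A n ∘ₗ hochschildD k A n := by
  have h1 : barD k A n ∘ₗ cyclicNorm k A (n + 1) =
      cyclicNorm k A n ∘ₗ mulAt k A n 0 ∘ₗ cyclicNorm k A (n + 1) := by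
    rw [barD, finset_sum_comp, cyclicNorm.eq_def k A n, finset_sum_comp, Finset.sum_range]
    refine Finset.sum_congr rfl fun i _ => ?_
    rw [← LinearMap.comp_assoc, ← mulAt_comp_cyclicT_pow, LinearMap.smul_comp, LinearMap.smul_comp,
      LinearMap.comp_assoc, ← Module.End.mul_eq_comp (cyclicT k A (n + 1) ^ i.val),
      cyclicT_pow_comp_cyclicNorm]
  have h2 : ∀ i : Fin (n + 1), cyclicNorm k A n ∘ₗ ((-1 : k) ^ i.val • mulAt k A n i) =
      cyclicNorm k A n ∘ₗ mulAt k A n 0 ∘ₗ (cyclicT k A (n + 1) ^ (n + 2 - i.val)) := by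
    intro i
    conv_rhs => rw [← cyclicNorm_comp_cyclicT_pow k A n i.val, Module.End.mul_eq_comp,
      LinearMap.comp_assoc, ← LinearMap.comp_assoc _ (mulAt k A n 0), ← mulAt_comp_cyclicT_pow,
      LinearMap.smul_comp, LinearMap.comp_assoc, ← Module.End.mul_eq_comp, ← pow_add,
      Nat.add_sub_cancel' (by omega : i.val ≤ n + 2), cyclicT_pow]
    rfl
  have h3 : cyclicNorm k A (n + 1) =
      ∑ i : Fin (n + 1), cyclicT k A (n + 1) ^ (n + 2 - i.val) + cyclicT k A (n + 1) := by
    rw [Fin.sum_univ_eq_sum_range (fun i => cyclicT k A (n + 1) ^ (n + 2 - i)) (n + 1)]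
    have := Finset.sum_range_reflect (fun i => cyclicT k A (n + 1) ^ (i + 1)) (n + 2)
    rw [Finset.sum_range_succ, Finset.sum_range_succ _ (n + 1), cyclicT_pow] at this
    rw [cyclicNorm, Finset.sum_range_succ', pow_zero, ← this]
    congr 1
    · refine Finset.sum_congr rfl fun i hi => ?_
      rw [Finset.mem_range] at hi
      congr 1
      omega
    · simp
  rw [h1, hochschildD_eq, LinearMap.comp_add, barD, comp_finset_sum]
  simp only [h2]
  rw [← comp_finset_sum, ← comp_finset_sum, ← LinearMap.comp_add, ← LinearMap.comp_add, ← h3]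

end Hochschild

/-- The category of (non-unital, associative) algebras over the field `k`. -/
structure NonUnitalAlgCat (k : Type u) [Field k] where
  /-- the underlying type -/
  carrier : Type v
  [ring : NonUnitalRing carrier]
  [module : Module k carrier]
  [isScalarTower : IsScalarTower k carrier carrier]
  [smulCommClass : SMulCommClass k carrier carrier]

namespace NonUnitalAlgCat

attribute [instance] ring module isScalarTower smulCommClass

instance (k : Type u) [Field k] : Category (NonUnitalAlgCat.{u, v} k) where
  Hom A B := A.carrier →ₙₐ[k] B.carrier
  id A := NonUnitalAlgHom.id k A.carrier
  comp f g := NonUnitalAlgHom.comp g f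

end NonUnitalAlgCat

section Complexes

variable {k : Type u} [Field k] {A B : Type v}
  [NonUnitalRing A] [Module k A] [IsScalarTower k A A] [SMulCommClass k A A]
  [NonUnitalRing B] [Module k B] [IsScalarTower k B B] [SMulCommClass k B B]

/-- The map `A^{⊗(n+1)} → B^{⊗(n+1)}` induced by an algebra homomorphism `A → B`. -/
def chainsMap (f : A →ₙₐ[k] B) (n : ℕ) : HochschildChains k A n →ₗ[k] HochschildChains k B n :=
  PiTensorProduct.map (fun _ => (f : A →ₗ[k] B))

set_option linter.unusedSectionVars false in
theorem chainsMap_tprod (f : A →ₙₐ[k] B) (n : ℕ) (g : Fin (n + 1) → A) :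
    chainsMap f n (PiTensorProduct.tprod k g) = PiTensorProduct.tprod k (fun i => f (g i)) := by
  simp [chainsMap]

theorem chainsMap_comp_mulAt (f : A →ₙₐ[k] B) (n : ℕ) (i : Fin (n + 1)) :
    chainsMap f n ∘ₗ mulAt k A n i = mulAt k B n i ∘ₗ chainsMap f (n + 1) := by
  refine PiTensorProduct.ext (MultilinearMap.ext fun g => ?_)
  simp only [LinearMap.compMultilinearMap_apply, LinearMap.comp_apply, mulAt_tprod,
    chainsMap_tprod]
  congr 1
  exact Fin.comp_contractNth (· * ·) (· * ·) (map_mul f) i.castSucc g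

theorem chainsMap_comp_rotate (f : A →ₙₐ[k] B) (n : ℕ) :
    chainsMap f n ∘ₗ rotate k A n = rotate k B n ∘ₗ chainsMap f n := by
  refine PiTensorProduct.ext (MultilinearMap.ext fun g => ?_)
  simp only [LinearMap.compMultilinearMap_apply, LinearMap.comp_apply, rotate_tprod,
    chainsMap_tprod]

theorem chainsMap_comp_cyclicT (f : A →ₙₐ[k] B) (n : ℕ) :
    chainsMap f n ∘ₗ cyclicT k A n = cyclicT k B n ∘ₗ chainsMap f n := by
  simp only [cyclicT, LinearMap.comp_smul, LinearMap.smul_comp, chainsMap_comp_rotate]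

theorem chainsMap_comp_cyclicNorm (f : A →ₙₐ[k] B) (n : ℕ) :
    chainsMap f n ∘ₗ cyclicNorm k A n = cyclicNorm k B n ∘ₗ chainsMap f n := by
  rw [cyclicNorm, cyclicNorm, comp_finset_sum, finset_sum_comp]
  refine Finset.sum_congr rfl fun i hi => ?_
  clear hi
  induction i with
  | zero => rfl
  | succ i ih =>
    rw [pow_succ', pow_succ', Module.End.mul_eq_comp, Module.End.mul_eq_comp,
      ← LinearMap.comp_assoc, chainsMap_comp_cyclicT, LinearMap.comp_assoc, ih,
      LinearMap.comp_assoc]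

theorem chainsMap_comp_barD (f : A →ₙₐ[k] B) (n : ℕ) :
    chainsMap f n ∘ₗ barD k A n = barD k B n ∘ₗ chainsMap f (n + 1) := by
  simp only [barD, comp_finset_sum, finset_sum_comp, LinearMap.comp_smul, LinearMap.smul_comp,
    chainsMap_comp_mulAt]

theorem chainsMap_comp_hochschildD (f : A →ₙₐ[k] B) (n : ℕ) :
    chainsMap f n ∘ₗ hochschildD k A n = hochschildD k B n ∘ₗ chainsMap f (n + 1) := by
  rw [hochschildD_eq, hochschildD_eq, LinearMap.comp_add, LinearMap.add_comp, chainsMap_comp_barD,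
    ← LinearMap.comp_assoc, chainsMap_comp_mulAt, LinearMap.comp_assoc, LinearMap.comp_assoc,
    chainsMap_comp_cyclicT]

theorem chainsMap_id (n : ℕ) : chainsMap (NonUnitalAlgHom.id k A) n = LinearMap.id := by
  refine PiTensorProduct.ext (MultilinearMap.ext fun g => ?_)
  simp [chainsMap_tprod]

theorem chainsMap_comp {C : Type v} [NonUnitalRing C] [Module k C] [IsScalarTower k C C]
    [SMulCommClass k C C] (g : B →ₙₐ[k] C) (f : A →ₙₐ[k] B) (n : ℕ) :
    chainsMap (g.comp f) n = chainsMap g n ∘ₗ chainsMap f n := by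
  refine PiTensorProduct.ext (MultilinearMap.ext fun g => ?_)
  simp [chainsMap_tprod]

variable (k)

/-- The Hochschild complex `C(A)`, with differential `b`, as a functor of the algebra `A`. -/
def hochschildComplex : NonUnitalAlgCat.{u, v} k ⥤ ChainComplex (ModuleCat.{max u v} k) ℕ where
  obj A := ChainComplex.of (fun n => ModuleCat.of k (HochschildChains k A.carrier n))
    (fun n => ModuleCat.ofHom (hochschildD k A.carrier n))
    (fun n => by rw [← ModuleCat.ofHom_comp, hochschildD_comp_hochschildD]; rfl)
  map f := ChainComplex.ofHom (fun n => ModuleCat.ofHom (chainsMap f n)) (fun n => by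
    dsimp only
    rw [ChainComplex.of_d, ChainComplex.of_d, ← ModuleCat.ofHom_comp, ← ModuleCat.ofHom_comp,
      chainsMap_comp_hochschildD])
  map_id A := by
    ext n : 2
    exact chainsMap_id (k := k) (A := A.carrier) n
  map_comp f g := by
    ext n : 2
    exact chainsMap_comp g f n

/-- The bar complex `C^bar(A)`, with differential `b'`, as a functor of the algebra `A`. -/
def barComplex : NonUnitalAlgCat.{u, v} k ⥤ ChainComplex (ModuleCat.{max u v} k) ℕ where
  obj A := ChainComplex.of (fun n => ModuleCat.of k (HochschildChains k A.carrier n))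
    (fun n => ModuleCat.ofHom (barD k A.carrier n))
    (fun n => by rw [← ModuleCat.ofHom_comp, barD_comp_barD]; rfl)
  map f := ChainComplex.ofHom (fun n => ModuleCat.ofHom (chainsMap f n)) (fun n => by
    dsimp only
    rw [ChainComplex.of_d, ChainComplex.of_d, ← ModuleCat.ofHom_comp, ← ModuleCat.ofHom_comp,
      chainsMap_comp_barD])
  map_id A := by
    ext n : 2
    exact chainsMap_id (k := k) (A := A.carrier) n
  map_comp f g := by
    ext n : 2
    exact chainsMap_comp g f n

/-- `1 - t : C^bar(A) → C(A)`. -/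
def oneSubCyclic : barComplex.{u, v} k ⟶ hochschildComplex k where
  app A := ChainComplex.ofHom
    (fun n => ModuleCat.ofHom (LinearMap.id - cyclicT k A.carrier n)) (fun n => by
      dsimp only [hochschildComplex, barComplex]
      rw [ChainComplex.of_d, ChainComplex.of_d, ← ModuleCat.ofHom_comp, ← ModuleCat.ofHom_comp,
        hochschildD_comp_one_sub_cyclicT])
  naturality A B f := by
    ext n : 2
    change (LinearMap.id - cyclicT k B.carrier n) ∘ₗ chainsMap f n =
      chainsMap f n ∘ₗ (LinearMap.id - cyclicT k A.carrier n)
    rw [LinearMap.sub_comp, LinearMap.comp_sub, chainsMap_comp_cyclicT, LinearMap.id_comp,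
      LinearMap.comp_id]

/-- `N : C(A) → C^bar(A)`. -/
def normCyclic : hochschildComplex.{u, v} k ⟶ barComplex k where
  app A := ChainComplex.ofHom
    (fun n => ModuleCat.ofHom (cyclicNorm k A.carrier n)) (fun n => by
      dsimp only [hochschildComplex, barComplex]
      rw [ChainComplex.of_d, ChainComplex.of_d, ← ModuleCat.ofHom_comp, ← ModuleCat.ofHom_comp,
        barD_comp_cyclicNorm])
  naturality A B f := by
    ext n : 2
    exact (chainsMap_comp_cyclicNorm f n).symm

theorem oneSubCyclic_normCyclic : oneSubCyclic.{u, v} k ≫ normCyclic k = 0 := by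
  ext A n : 4
  exact cyclicNorm_comp_one_sub_cyclicT k A.carrier n

theorem normCyclic_oneSubCyclic : normCyclic.{u, v} k ≫ oneSubCyclic k = 0 := by
  ext A n : 4
  exact one_sub_cyclicT_comp_cyclicNorm k A.carrier n

/-- The columns of the cyclic bicomplex: `C(A), C^bar(A), C(A), C^bar(A), …`. -/
def cyclicColumn : ℕ → (NonUnitalAlgCat.{u, v} k ⥤ ChainComplex (ModuleCat.{max u v} k) ℕ)
  | 0 => hochschildComplex k
  | 1 => barComplex k
  | p + 2 => cyclicColumn p

/-- The horizontal maps of the cyclic bicomplex: `1 - t, N, 1 - t, N, …`. -/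
def cyclicRowD : (p : ℕ) → (cyclicColumn.{u, v} k (p + 1) ⟶ cyclicColumn k p)
  | 0 => oneSubCyclic k
  | 1 => normCyclic k
  | p + 2 => cyclicRowD p

theorem cyclicRowD_comp : (p : ℕ) → cyclicRowD.{u, v} k (p + 1) ≫ cyclicRowD k p = 0
  | 0 => normCyclic_oneSubCyclic k
  | 1 => oneSubCyclic_normCyclic k
  | p + 2 => cyclicRowD_comp p

/-- The columns of the cyclic bicomplex, with all columns of index `≥ 2` deleted. -/
def cyclicColumn₂ : ℕ → (NonUnitalAlgCat.{u, v} k ⥤ ChainComplex (ModuleCat.{max u v} k) ℕ)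
  | 0 => hochschildComplex k
  | 1 => barComplex k
  | _ + 2 => (Functor.const _).obj 0

/-- The horizontal maps of the bicomplex with two columns. -/
def cyclicRowD₂ : (p : ℕ) → (cyclicColumn₂.{u, v} k (p + 1) ⟶ cyclicColumn₂ k p)
  | 0 => oneSubCyclic k
  | _ + 1 => 0

theorem cyclicRowD₂_comp : (p : ℕ) → cyclicRowD₂.{u, v} k (p + 1) ≫ cyclicRowD₂ k p = 0
  | 0 => Limits.zero_comp
  | _ + 1 => Limits.zero_comp

/-- The cyclic bicomplex of an algebra. In the total complex below the differential of the column
of index `p` gets the sign `(-1)^p`. -/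
def cyclicBicomplex : NonUnitalAlgCat.{u, v} k ⥤
    HomologicalComplex₂ (ModuleCat.{max u v} k) (ComplexShape.down ℕ) (ComplexShape.down ℕ) :=
  (ChainComplex.of (cyclicColumn k) (cyclicRowD k) (cyclicRowD_comp k)).asFunctor

/-- The first two columns of the cyclic bicomplex of an algebra. -/
def cyclicBicomplex₂ : NonUnitalAlgCat.{u, v} k ⥤
    HomologicalComplex₂ (ModuleCat.{max u v} k) (ComplexShape.down ℕ) (ComplexShape.down ℕ) :=
  (ChainComplex.of (cyclicColumn₂ k) (cyclicRowD₂ k) (cyclicRowD₂_comp k)).asFunctor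

/-- The complex `CC(A)`. -/
def cyclicComplex : NonUnitalAlgCat.{u, v} k ⥤ ChainComplex (ModuleCat.{max u v} k) ℕ :=
  cyclicBicomplex k ⋙ HomologicalComplex₂.totalFunctor _ _ _ _

/-- The complex `CC^{2}(A)`. -/
def cyclicComplex₂ : NonUnitalAlgCat.{u, v} k ⥤ ChainComplex (ModuleCat.{max u v} k) ℕ :=
  cyclicBicomplex₂ k ⋙ HomologicalComplex₂.totalFunctor _ _ _ _

end Complexes

/-- A crossed module `(R, A, ρ)` of algebras: an algebra homomorphism `ρ : R → A` and an action of
`A` on `R`, that is, an `A`-bimodule structure compatible with the multiplication of `R`. -/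
structure AlgCrossedModule (k : Type u) [Field k] (R A : Type v)
    [NonUnitalRing R] [Module k R] [IsScalarTower k R R] [SMulCommClass k R R]
    [NonUnitalRing A] [Module k A] [IsScalarTower k A A] [SMulCommClass k A A] where
  /-- the structure homomorphism -/
  ρ : R →ₙₐ[k] A
  /-- the left action `a, r ↦ a r` -/
  lact : A →ₗ[k] R →ₗ[k] R
  /-- the right action `r, a ↦ r a` -/
  ract : R →ₗ[k] A →ₗ[k] R
  mul_lact : ∀ a a' r, lact (a * a') r = lact a (lact a' r)
  ract_mul : ∀ r a a', ract r (a * a') = ract (ract r a) a'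
  lact_ract : ∀ a r a', ract (lact a r) a' = lact a (ract r a')
  lact_mul : ∀ a r r', lact a (r * r') = lact a r * r'
  ract_mul_eq : ∀ r a r', ract r a * r' = r * lact a r'
  mul_ract : ∀ r r' a, ract (r * r') a = r * ract r' a
  ρ_lact : ∀ a r, ρ (lact a r) = a * ρ r
  ρ_ract : ∀ r a, ρ (ract r a) = ρ r * a
  peiffer_left : ∀ r r', lact (ρ r) r' = r * r'
  peiffer_right : ∀ r r', ract r (ρ r') = r * r'

namespace AlgCrossedModule

variable {k : Type u} [Field k] {R A : Type v}
  [NonUnitalRing R] [Module k R] [IsScalarTower k R R] [SMulCommClass k R R]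
  [NonUnitalRing A] [Module k A] [IsScalarTower k A A] [SMulCommClass k A A]
  (X : AlgCrossedModule k R A)

/-- The vector space of `n`-simplices `(r₁, …, rₙ, a)` of the nerve: a string of `n` composable
arrows between vertices `v₀, …, vₙ`, where `rⱼ` is an arrow from `vⱼ` to `vⱼ₋₁` and `vₙ = a`.
Indices of the `r` are shifted by one. -/
def NerveObj (_ : AlgCrossedModule k R A) (n : ℕ) : Type v := (Fin n → R) × A

namespace NerveObj

variable {X} {n : ℕ}

instance : AddCommGroup (X.NerveObj n) := inferInstanceAs (AddCommGroup ((Fin n → R) × A))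

instance : Module k (X.NerveObj n) := inferInstanceAs (Module k ((Fin n → R) × A))

/-- The string of arrows `(r₁, …, rₙ)` of a simplex `(r₁, …, rₙ, a)`. -/
def arr (x : X.NerveObj n) : Fin n → R := x.1

/-- The last vertex `a` of a simplex `(r₁, …, rₙ, a)`. -/
def src (x : X.NerveObj n) : A := x.2

/-- The composite arrow `rᵢ₊₁ + ⋯ + rₙ` from `vₙ` to `vᵢ`. -/
def tail (x : X.NerveObj n) (i : Fin (n + 1)) : R := ∑ l with i ≤ l.castSucc, x.arr l

/-- The vertex `vᵢ = ρ(rᵢ₊₁ + ⋯ + rₙ) + a`. -/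
def vertex (x : X.NerveObj n) (i : Fin (n + 1)) : A := X.ρ (tail x i) + x.src

/-- The multiplication of the iterated semidirect product `R ⋊ (⋯ ⋊ (R ⋊ A))`: the elements of
the `j`-th factor `R` are multiplied by those of the inner semidirect product through the action
of the vertex `vⱼ`. -/
instance : Mul (X.NerveObj n) where
  mul x y := (fun j => x.arr j * y.arr j + X.lact (x.vertex j.succ) (y.arr j) +
    X.ract (x.arr j) (y.vertex j.succ), x.src * y.src)

theorem add_arr (x y : X.NerveObj n) (j : Fin n) : (x + y).arr j = x.arr j + y.arr j := rfl
theorem add_src (x y : X.NerveObj n) : (x + y).src = x.src + y.src := rfl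
theorem zero_arr (j : Fin n) : (0 : X.NerveObj n).arr j = 0 := rfl
theorem zero_src : (0 : X.NerveObj n).src = 0 := rfl
theorem smul_arr (c : k) (x : X.NerveObj n) (j : Fin n) : (c • x).arr j = c • x.arr j := rfl
theorem smul_src (c : k) (x : X.NerveObj n) : (c • x).src = c • x.src := rfl
theorem mul_arr (x y : X.NerveObj n) (j : Fin n) : (x * y).arr j = x.arr j * y.arr j +
    X.lact (x.vertex j.succ) (y.arr j) + X.ract (x.arr j) (y.vertex j.succ) := rfl
theorem mul_src (x y : X.NerveObj n) : (x * y).src = x.src * y.src := rfl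

theorem tail_add (x y : X.NerveObj n) (i : Fin (n + 1)) : (x + y).tail i = x.tail i + y.tail i := by
  simp only [tail, add_arr, Finset.sum_add_distrib]

theorem tail_zero (i : Fin (n + 1)) : (0 : X.NerveObj n).tail i = 0 := by
  simp only [tail, zero_arr, Finset.sum_const_zero]

theorem tail_smul (c : k) (x : X.NerveObj n) (i : Fin (n + 1)) :
    (c • x).tail i = c • x.tail i := by
  simp only [tail, smul_arr, Finset.smul_sum]

theorem tail_last (x : X.NerveObj n) : x.tail (Fin.last n) = 0 := by
  refine Finset.sum_eq_zero fun l hl => ?_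
  simp only [Finset.mem_filter, Fin.le_def, Fin.val_last, Fin.val_castSucc] at hl
  omega

theorem tail_castSucc (x : X.NerveObj n) (j : Fin n) :
    x.tail j.castSucc = x.arr j + x.tail j.succ := by
  have : (Finset.univ.filter fun l : Fin n => j.castSucc ≤ l.castSucc) =
      insert j (Finset.univ.filter fun l : Fin n => j.succ ≤ l.castSucc) := by
    ext l
    simp only [Finset.mem_filter, Finset.mem_insert, Finset.mem_univ, Fin.le_def, Fin.ext_iff,
      Fin.val_castSucc, Fin.val_succ, true_and]
    omega
  rw [tail, this, Finset.sum_insert (by simp [Fin.le_def]), tail]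

theorem ext_of_tail {x y : X.NerveObj n} (h : ∀ i, x.tail i = y.tail i) (h' : x.src = y.src) :
    x = y := by
  refine Prod.ext (funext fun j => (?_ : x.arr j = y.arr j)) h'
  have h1 := h j.castSucc
  rwa [tail_castSucc, tail_castSucc, h j.succ, add_left_inj] at h1

theorem tail_mul (x y : X.NerveObj n) (i : Fin (n + 1)) : (x * y).tail i =
    x.tail i * y.tail i + X.lact x.src (y.tail i) + X.ract (x.tail i) y.src := by
  induction i using Fin.reverseInduction with
  | last => simp [tail_last]
  | cast j ih =>
    simp only [tail_castSucc, ih, mul_arr, vertex, map_add, LinearMap.add_apply, X.peiffer_left,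
      X.peiffer_right, mul_add, add_mul]
    abel

instance : NonUnitalRing (X.NerveObj n) where
  left_distrib x y z := ext_of_tail (fun i => by
    simp only [tail_mul, tail_add, mul_add, map_add, add_src]; abel)
    (by simp only [mul_src, add_src, mul_add])
  right_distrib x y z := ext_of_tail (fun i => by
    simp only [tail_mul, tail_add, add_mul, map_add, LinearMap.add_apply, add_src]; abel)
    (by simp only [mul_src, add_src, add_mul])
  zero_mul x := ext_of_tail (fun i => by
    simp [tail_mul, tail_zero, zero_src]) (by simp [mul_src, zero_src])
  mul_zero x := ext_of_tail (fun i => by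
    simp [tail_mul, tail_zero, zero_src]) (by simp [mul_src, zero_src])
  mul_assoc x y z := ext_of_tail (fun i => by
    simp only [tail_mul, mul_src, map_add, LinearMap.add_apply, mul_add, add_mul, X.mul_lact,
      X.ract_mul, X.lact_ract, X.lact_mul, X.ract_mul_eq, X.mul_ract, mul_assoc]
    abel) (by simp only [mul_src, mul_assoc])

instance : IsScalarTower k (X.NerveObj n) (X.NerveObj n) where
  smul_assoc c x y := ext_of_tail (fun i => by
    simp only [smul_eq_mul, tail_mul, tail_smul, smul_src, map_smul, LinearMap.smul_apply,
      smul_mul_assoc, smul_add]) (by simp only [smul_eq_mul, mul_src, smul_src, smul_mul_assoc])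

instance : SMulCommClass k (X.NerveObj n) (X.NerveObj n) where
  smul_comm c x y := ext_of_tail (fun i => by
    simp only [smul_eq_mul, tail_mul, tail_smul, smul_src, map_smul,
      mul_smul_comm, smul_add]) (by simp only [smul_eq_mul, mul_src, smul_src, mul_smul_comm])

/-- The operator of the nerve given by a monotone map `θ : [m] → [n]`: the arrows of a string of
arrows are composed, and identities inserted, along `θ`. -/
def comapFun {m : ℕ} (θ : Fin (m + 1) →o Fin (n + 1)) (x : X.NerveObj n) : X.NerveObj m :=
  (fun j => ∑ l with θ j.castSucc ≤ l.castSucc ∧ l.castSucc < θ j.succ, x.arr l,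
    x.vertex (θ (Fin.last m)))

theorem comapFun_arr {m : ℕ} (θ : Fin (m + 1) →o Fin (n + 1)) (x : X.NerveObj n) (j : Fin m) :
    (comapFun θ x).arr j = x.tail (θ j.castSucc) - x.tail (θ j.succ) := by
  change ∑ l with θ j.castSucc ≤ l.castSucc ∧ l.castSucc < θ j.succ, x.arr l = _
  rw [eq_sub_iff_add_eq, tail, tail, ← Finset.sum_union]
  · refine Finset.sum_congr ?_ fun _ _ => rfl
    have := θ.monotone j.castSucc_le_succ
    ext l
    simp only [Finset.mem_union, Finset.mem_filter, Finset.mem_univ, true_and]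
    constructor
    · rintro (h | h)
      exacts [h.1, this.trans h]
    · intro h
      by_cases h' : l.castSucc < θ j.succ
      exacts [Or.inl ⟨h, h'⟩, Or.inr (not_lt.1 h')]
  · refine Finset.disjoint_filter.2 fun l _ h => not_le.2 h.2

theorem tail_comapFun {m : ℕ} (θ : Fin (m + 1) →o Fin (n + 1)) (x : X.NerveObj n)
    (i : Fin (m + 1)) :
    (comapFun θ x).tail i = x.tail (θ i) - x.tail (θ (Fin.last m)) := by
  induction i using Fin.reverseInduction with
  | last => rw [tail_last, sub_self]
  | cast j ih => rw [tail_castSucc, ih, comapFun_arr]; abel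

theorem comapFun_src {m : ℕ} (θ : Fin (m + 1) →o Fin (n + 1)) (x : X.NerveObj n) :
    (comapFun θ x).src = X.ρ (x.tail (θ (Fin.last m))) + x.src := rfl

/-- `NerveObj.comapFun` as an algebra homomorphism. -/
def comap {m : ℕ} (θ : Fin (m + 1) →o Fin (n + 1)) : X.NerveObj n →ₙₐ[k] X.NerveObj m where
  toFun := comapFun θ
  map_smul' c x := ext_of_tail (fun i => by
    simp only [tail_comapFun, tail_smul, smul_sub, MonoidHom.id_apply]) (by
    simp only [comapFun_src, tail_smul, smul_src, map_smul, smul_add, MonoidHom.id_apply])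
  map_zero' := ext_of_tail (fun i => by
    simp only [tail_comapFun, tail_zero, sub_zero]) (by
    simp only [comapFun_src, tail_zero, zero_src, map_zero, add_zero])
  map_add' x y := ext_of_tail (fun i => by
    simp only [tail_comapFun, tail_add]; abel) (by
    simp only [comapFun_src, tail_add, add_src, map_add]; abel)
  map_mul' x y := ext_of_tail (fun i => by
    simp only [tail_comapFun, tail_mul, comapFun_src, map_add, map_sub, LinearMap.add_apply,
      LinearMap.sub_apply, mul_sub, sub_mul, X.peiffer_left, X.peiffer_right]
    abel) (by
    simp only [comapFun_src, tail_mul, mul_src, map_add, X.ρ_lact, X.ρ_ract, map_mul, mul_add,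
      add_mul]
    abel)

end NerveObj

/-- The nerve of a crossed module of algebras, a simplicial algebra. -/
def nerve : SimplicialObject (NonUnitalAlgCat.{u, v} k) where
  obj n := ⟨X.NerveObj n.unop.len⟩
  map f := NerveObj.comap f.unop.toOrderHom
  map_id n := by
    refine NonUnitalAlgHom.ext fun x => NerveObj.ext_of_tail (fun i => ?_) ?_
    · refine (NerveObj.tail_comapFun _ x i).trans ?_
      exact (congrArg (x.tail i - ·) x.tail_last).trans (sub_zero _)
    · refine (NerveObj.comapFun_src _ x).trans ?_
      exact (congrArg (X.ρ · + x.src) x.tail_last).trans ((congrArg (· + x.src) (map_zero X.ρ)).trans (zero_add _))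
  map_comp f g := by
    refine NonUnitalAlgHom.ext fun x => NerveObj.ext_of_tail (fun i => ?_) ?_
    · refine (NerveObj.tail_comapFun _ x i).trans ?_
      refine Eq.trans ?_ (NerveObj.tail_comapFun _ (NerveObj.comapFun f.unop.toOrderHom x) i).symm
      rw [NerveObj.tail_comapFun, NerveObj.tail_comapFun, sub_sub_sub_cancel_right]
      rfl
    · refine (NerveObj.comapFun_src _ x).trans ?_
      refine Eq.trans ?_ (NerveObj.comapFun_src _ (NerveObj.comapFun f.unop.toOrderHom x)).symm
      rw [NerveObj.tail_comapFun, NerveObj.comapFun_src, map_sub, ← add_assoc, sub_add_cancel]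
      rfl

/-- The cokernel algebra `Coker ρ = A / ρ(R)`. -/
def Coker : Type v := A ⧸ LinearMap.range (X.ρ : R →ₗ[k] A)

/-- The kernel of `ρ`. -/
abbrev ker : Submodule k R := LinearMap.ker (X.ρ : R →ₗ[k] A)

/-- `[A, Ker ρ]`, as a subspace of `Ker ρ`. -/
def kerCommutator : Submodule k X.ker :=
  Submodule.span k {y | ∃ (a : A) (x : X.ker), (y : R) = X.lact a x - X.ract x a}

namespace Coker

instance : AddCommGroup X.Coker :=
  inferInstanceAs (AddCommGroup (A ⧸ LinearMap.range (X.ρ : R →ₗ[k] A)))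

instance : Module k X.Coker :=
  inferInstanceAs (Module k (A ⧸ LinearMap.range (X.ρ : R →ₗ[k] A)))

/-- The projection `A → Coker ρ`. -/
def mk : A →ₗ[k] X.Coker := (LinearMap.range (X.ρ : R →ₗ[k] A)).mkQ

theorem mk_surjective : Function.Surjective (mk X) := Submodule.mkQ_surjective _

theorem mk_ρ (r : R) : mk X (X.ρ r) = 0 :=
  (Submodule.Quotient.mk_eq_zero _).2 ⟨r, rfl⟩

/-- The multiplication of `Coker ρ` as a bilinear map. -/
def mulₗ : X.Coker →ₗ[k] X.Coker →ₗ[k] X.Coker :=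
  Submodule.liftQ _ (LinearMap.flip (Submodule.liftQ _
    (LinearMap.flip ((LinearMap.mul k A).compr₂ (mk X))) (by
      rintro _ ⟨r, rfl⟩
      refine LinearMap.ext fun a => ?_
      exact (congrArg (mk X) (X.ρ_lact a r).symm).trans (mk_ρ X _)))) (by
      rintro _ ⟨r, rfl⟩
      refine LinearMap.ext fun b => ?_
      obtain ⟨a, rfl⟩ := mk_surjective X b
      exact (congrArg (mk X) (X.ρ_ract r a).symm).trans (mk_ρ X _))

instance : Mul X.Coker where
  mul x y := mulₗ X x y

theorem mk_mul (a b : A) : mk X (a * b) = mk X a * mk X b := rfl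

instance : NonUnitalRing X.Coker where
  left_distrib x y z := map_add (mulₗ X x) y z
  right_distrib x y z := LinearMap.map_add₂ (mulₗ X) x y z
  zero_mul x := LinearMap.map_zero₂ (mulₗ X) x
  mul_zero x := map_zero (mulₗ X x)
  mul_assoc x y z := by
    obtain ⟨a, rfl⟩ := mk_surjective X x
    obtain ⟨b, rfl⟩ := mk_surjective X y
    obtain ⟨c, rfl⟩ := mk_surjective X z
    simp only [← mk_mul, mul_assoc]

instance : IsScalarTower k X.Coker X.Coker where
  smul_assoc c x y := LinearMap.map_smul₂ (mulₗ X) c x y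

instance : SMulCommClass k X.Coker X.Coker where
  smul_comm c x y := (map_smul (mulₗ X x) c y).symm

end Coker

/-- The augmentation `A → Coker ρ` of the nerve. -/
def augmentation : X.nerve.obj (Opposite.op (SimplexCategory.mk 0)) ⟶
    (⟨X.Coker⟩ : NonUnitalAlgCat.{u, v} k) :=
  ({ toFun := fun x => Coker.mk X x.src
     map_smul' := fun c x => map_smul (Coker.mk X) c x.src
     map_zero' := map_zero (Coker.mk X)
     map_add' := fun x y => map_add (Coker.mk X) x.src y.src
     map_mul' := fun x y => Coker.mk_mul X x.src y.src } : X.NerveObj 0 →ₙₐ[k] X.Coker)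

theorem augmentation_naturality {n : ℕ} (θ : Fin (0 + 1) →o Fin (n + 1)) (x : X.NerveObj n) :
    Coker.mk X (NerveObj.comapFun θ x).src = Coker.mk X x.src := by
  rw [NerveObj.comapFun_src, map_add, Coker.mk_ρ, zero_add]

end AlgCrossedModule

section Total

variable {k : Type u} [Field k]
  (K : HomologicalComplex₂ (ModuleCat.{v} k) (ComplexShape.down ℕ) (ComplexShape.down ℕ))
  (Y : ChainComplex (ModuleCat.{v} k) ℕ) (e : K.X 0 ⟶ Y)

/-- The map from the `(p, q)` spot of a bicomplex to the degree `n = p + q` of `Y` that is given by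
`e : K.X 0 ⟶ Y` for `p = 0` and vanishes for `p > 0`. -/
def augmentationComponent : (p q n : ℕ) → (p + q = n) → ((K.X p).X q ⟶ Y.X n)
  | 0, q, _, h => e.f q ≫ (Y.XIsoOfEq ((Nat.zero_add q).symm.trans h)).hom
  | _ + 1, _, _, _ => 0

theorem augmentationComponent_zero (n : ℕ) (h : 0 + n = n) :
    augmentationComponent K Y e 0 n n h = e.f n := by
  simp [augmentationComponent]

theorem augmentationComponent_succ (p q n : ℕ) (h : p + 1 + q = n) :
    augmentationComponent K Y e (p + 1) q n h = 0 := rfl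

/-- The chain map `Tot K ⟶ Y` induced by an augmentation `K.X 0 ⟶ Y` of the column of index `0`;
it vanishes on the other columns. -/
def totalAugmentation [K.HasTotal (ComplexShape.down ℕ)] (he : K.d 1 0 ≫ e = 0) :
    K.total (ComplexShape.down ℕ) ⟶ Y where
  f n := K.totalDesc (fun p q h => augmentationComponent K Y e p q n h)
  comm' n m hnm := by
    obtain rfl : m + 1 = n := hnm
    apply HomologicalComplex₂.total.hom_ext
    intro p q h
    rw [HomologicalComplex₂.total_d, Preadditive.add_comp, Preadditive.comp_add,
      HomologicalComplex₂.ι_D₁_assoc, HomologicalComplex₂.ι_D₂_assoc,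
      HomologicalComplex₂.ι_totalDesc_assoc]
    have h' : p + q = m + 1 := h
    obtain _ | p := p
    · obtain rfl : q = m + 1 := by omega
      rw [HomologicalComplex₂.d₁_eq_zero K _ 0 _ _ (by simp), Limits.zero_comp, zero_add,
        HomologicalComplex₂.d₂_eq K (ComplexShape.down ℕ) 0 (i₂' := m) rfl m (Nat.zero_add m),
        Linear.units_smul_comp, Category.assoc, HomologicalComplex₂.ι_totalDesc,
        augmentationComponent_zero, augmentationComponent_zero, e.comm]
      exact (one_smul ℤˣ _).symm
    · have h1 : K.d₂ (ComplexShape.down ℕ) (p + 1) q m ≫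
          K.totalDesc (fun p q h => augmentationComponent K Y e p q m h) = 0 := by
        obtain _ | q := q
        · rw [HomologicalComplex₂.d₂_eq_zero K _ _ 0 _ (by simp), Limits.zero_comp]
        · rw [HomologicalComplex₂.d₂_eq K (ComplexShape.down ℕ) (p + 1) (i₂' := q) rfl m
              (by change p + 1 + q = m; omega),
            Linear.units_smul_comp, Category.assoc, HomologicalComplex₂.ι_totalDesc,
            augmentationComponent_succ, Limits.comp_zero, smul_zero]
      rw [h1, augmentationComponent_succ, Limits.zero_comp, add_zero,
        HomologicalComplex₂.d₁_eq K (ComplexShape.down ℕ) (i₁' := p) rfl q m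
          (by change p + q = m; omega),
        Linear.units_smul_comp, Category.assoc, HomologicalComplex₂.ι_totalDesc]
      obtain _ | p := p
      · obtain rfl : q = m := by omega
        rw [augmentationComponent_zero]
        have := congrArg (fun φ => HomologicalComplex.Hom.f φ q) he
        exact (congrArg _ this).trans (smul_zero _) |>.symm
      · rw [augmentationComponent_succ, Limits.comp_zero, smul_zero]

end Total

section SimplicialAlgebras

variable {k : Type u} [Field k]

/-- The bicomplex `Φ(S)` of a simplicial algebra `S`: its column of index `p` is `Φ(Sₚ)`, its
horizontal differentials are the alternating sums of the maps induced by the faces. In the total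
complex the differential of the column of index `p` gets the sign `(-1)^p`. -/
def simplicialBicomplex
    (Φ : NonUnitalAlgCat.{u, v} k ⥤ ChainComplex (ModuleCat.{max u v} k) ℕ)
    (S : SimplicialObject (NonUnitalAlgCat.{u, v} k)) :
    HomologicalComplex₂ (ModuleCat.{max u v} k) (ComplexShape.down ℕ) (ComplexShape.down ℕ) :=
  (AlgebraicTopology.alternatingFaceMapComplex _).obj
    (((SimplicialObject.whiskering _ _).obj Φ).obj S)

/-- `h` is the homology class of the `n`-chain `c`, which in particular is a cycle. -/
def IsHomologyClass (K : ChainComplex (ModuleCat.{v} k) ℕ) (n : ℕ) (c : K.X n)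
    (h : K.homology n) : Prop :=
  ∃ z : K.cycles n, K.iCycles n z = c ∧ K.homologyπ n z = h

/-- The inclusion of `B` as the `(0, 0)` spot of the two columns bicomplex. -/
def hochschildZeroChain (B : NonUnitalAlgCat.{u, v} k) (b : B.carrier) :
    ((cyclicComplex₂ k).obj B).X 0 :=
  ((cyclicBicomplex₂ k).obj B).ιTotal (ComplexShape.down ℕ) 0 0 0 rfl
    (PiTensorProduct.tprod k (fun _ => b) : HochschildChains k B.carrier 0)

/-- The inclusion of `B` as the `(0, 0)` spot of the cyclic bicomplex. -/
def cyclicZeroChain (B : NonUnitalAlgCat.{u, v} k) (b : B.carrier) :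
    ((cyclicComplex k).obj B).X 0 :=
  ((cyclicBicomplex k).obj B).ιTotal (ComplexShape.down ℕ) 0 0 0 rfl
    (PiTensorProduct.tprod k (fun _ => b) : HochschildChains k B.carrier 0)

end SimplicialAlgebras

section Algebras

variable (k : Type u) [Field k] (B : Type v)
  [NonUnitalRing B] [Module k B] [IsScalarTower k B B] [SMulCommClass k B B]

/-- Hochschild homology `HHₙ(B)` of a (non-unital) algebra. -/
abbrev HH (n : ℕ) : ModuleCat.{max u v} k :=
  ((cyclicComplex₂ k).obj (⟨B⟩ : NonUnitalAlgCat.{u, v} k)).homology n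

/-- Cyclic homology `HCₙ(B)` of a (non-unital) algebra. -/
abbrev HC (n : ℕ) : ModuleCat.{max u v} k :=
  ((cyclicComplex k).obj (⟨B⟩ : NonUnitalAlgCat.{u, v} k)).homology n

/-- The subspace `[B, B]` spanned by the commutators. -/
def commutatorSubspace : Submodule k B := Submodule.span k {y | ∃ a b : B, y = a * b - b * a}

end Algebras

namespace AlgCrossedModule

variable {k : Type u} [Field k] {R A : Type v}
  [NonUnitalRing R] [Module k R] [IsScalarTower k R R] [SMulCommClass k R R]
  [NonUnitalRing A] [Module k A] [IsScalarTower k A A] [SMulCommClass k A A]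
  (X : AlgCrossedModule k R A)
  (Φ : NonUnitalAlgCat.{u, v} k ⥤ ChainComplex (ModuleCat.{max u v} k) ℕ)

/-- The complex `Φ(R, A, ρ)`, the total complex of the bicomplex of the nerve. -/
def complex : ChainComplex (ModuleCat.{max u v} k) ℕ :=
  (simplicialBicomplex Φ X.nerve).total (ComplexShape.down ℕ)

theorem simplicialBicomplex_d_comp_augmentation :
    (simplicialBicomplex Φ X.nerve).d 1 0 ≫ Φ.map X.augmentation = 0 := by
  have h : X.nerve.δ (0 : Fin 2) ≫ X.augmentation = X.nerve.δ (1 : Fin 2) ≫ X.augmentation :=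
    NonUnitalAlgHom.ext fun x => (X.augmentation_naturality _ x).trans
      (X.augmentation_naturality _ x).symm
  have h' := congrArg Φ.map h
  rw [Φ.map_comp, Φ.map_comp] at h'
  have hd : (simplicialBicomplex Φ X.nerve).d 1 0 =
      Φ.map (X.nerve.δ (0 : Fin 2)) - Φ.map (X.nerve.δ (1 : Fin 2)) := by
    refine (AlgebraicTopology.alternatingFaceMapComplex_obj_d _ 0).trans ?_
    rw [AlgebraicTopology.AlternatingFaceMapComplex.objD, Fin.sum_univ_two, Fin.val_zero,
      Fin.val_one, pow_zero, pow_one, one_smul, neg_smul, one_smul, ← sub_eq_add_neg]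
    rfl
  refine (congrArg (· ≫ Φ.map X.augmentation) hd).trans ?_
  exact (Preadditive.sub_comp _ _ _).trans (sub_eq_zero.2 h')

/-- The natural chain map `Φ(R, A, ρ) ⟶ Φ(Coker ρ)`. -/
def toCoker : X.complex Φ ⟶ Φ.obj ⟨X.Coker⟩ :=
  totalAugmentation (simplicialBicomplex Φ X.nerve) _ (Φ.map X.augmentation)
    (X.simplicialBicomplex_d_comp_augmentation Φ)

/-- The inclusion of `Φ₀(𝔑ₚ(R, A, ρ))` into `Φₚ(R, A, ρ)`. -/
def rowZeroChain (p : ℕ) (c : (Φ.obj ⟨X.NerveObj p⟩).X 0) : (X.complex Φ).X p :=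
  (simplicialBicomplex Φ X.nerve).ιTotal (ComplexShape.down ℕ) p 0 p rfl c

/-- Hochschild homology of a crossed module. -/
abbrev HH (n : ℕ) : ModuleCat.{max u v} k := (X.complex (cyclicComplex₂ k)).homology n

/-- Cyclic homology of a crossed module. -/
abbrev HC (n : ℕ) : ModuleCat.{max u v} k := (X.complex (cyclicComplex k)).homology n

/-- The natural map `HHₙ(R, A, ρ) → HHₙ(Coker ρ)`. -/
def HHToCoker (n : ℕ) : X.HH n →ₗ[k] AlgHomology.HH k X.Coker n :=
  (HomologicalComplex.homologyMap (X.toCoker (cyclicComplex₂ k)) n).hom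

/-- The natural map `HCₙ(R, A, ρ) → HCₙ(Coker ρ)`. -/
def HCToCoker (n : ℕ) : X.HC n →ₗ[k] AlgHomology.HC k X.Coker n :=
  (HomologicalComplex.homologyMap (X.toCoker (cyclicComplex k)) n).hom

/-- `h ∈ HHₚ(R, A, ρ)` is the homology class of the `p`-simplex `x` of the nerve, regarded as an
element of `𝔑ₚ(R, A, ρ) ⊆ CC^{2}₀(𝔑ₚ(R, A, ρ)) ⊆ CC^{2}ₚ(R, A, ρ)`. -/
def IsHHClass {p : ℕ} (x : X.NerveObj p) (h : X.HH p) : Prop :=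
  IsHomologyClass (X.complex (cyclicComplex₂ k)) p
    (X.rowZeroChain (cyclicComplex₂ k) p (hochschildZeroChain ⟨X.NerveObj p⟩ x)) h

/-- `h ∈ HCₚ(R, A, ρ)` is the homology class of the `p`-simplex `x` of the nerve, regarded as an
element of `𝔑ₚ(R, A, ρ) ⊆ CC₀(𝔑ₚ(R, A, ρ)) ⊆ CCₚ(R, A, ρ)`. -/
def IsHCClass {p : ℕ} (x : X.NerveObj p) (h : X.HC p) : Prop :=
  IsHomologyClass (X.complex (cyclicComplex k)) p
    (X.rowZeroChain (cyclicComplex k) p (cyclicZeroChain ⟨X.NerveObj p⟩ x)) h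

/-- The `0`-simplex `a` of the nerve. -/
def zeroSimplex (a : A) : X.NerveObj 0 := (fun _ => 0, a)

/-- The `1`-simplex `(r, 0)` of the nerve. -/
def oneSimplex (r : R) : X.NerveObj 1 := (fun _ => r, 0)

end AlgCrossedModule

end

end AlgHomology

open AlgHomology

/-! Let Φ be one of the two functors, Tot the total complex of the columns Φ(𝔑ₚ), and Y = Φ(Coker
ρ). The augmentation A → Coker ρ induces a chain map Tot → Y. Both exact sequences are the end of
its long exact homology sequence, once it is known that Tot → Y is surjective and that its kernel L
has H₀(L) = 0 and H₁(L) = Ker ρ / [A, Ker ρ].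

Exact rows. Over a field there are linear maps σ : A → R and τ : Coker ρ → A with ρσ(a) + τ(ā) = a.
So a ↦ (σ(a), τ(ā)) is a linear choice of an arrow from τ(ā) to a. Its tensor powers contract the
start of the augmented rows, which makes Φₙ(𝔑₁) → Φₙ(𝔑₀) → Φₙ(Coker ρ) → 0 exact for all n
(`exists_of_chainsMap_augmentation_eq_zero`, `RowExact.total`). Neither multiplicativity of σ, τ nor
the characteristic plays a role. Surjectivity and H₀(L) = 0 follow. A chase in the bicomplex
(`exists_exact_sequence_totalAugmentation`) then moves each class of H₁(L) to the spot (1, 0): H₁(L)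
is the horizontal homology of the bottom row at Φ₀(𝔑₁), modulo the vertical boundaries of those y in
Φ₁(𝔑₁) whose two faces agree.

Low degrees. Here Φ₀(B) = B, and the differential Φ₁(B) → Φ₀(B) is the commutator map on the summand
B ⊗ B and zero on the other summand B, because 1 - t vanishes on B. This is all that is used about Φ
in low degrees (`LowDegreeChains`), which is why HH and HC have the same middle term. In the bottom
row, (r, a) goes to -ρ(r), and the image of 𝔑₂ consists of the identity arrows (0, a), so the
horizontal homology at 𝔑₁ is Ker ρ.

Relations. The element (ax - xa, 0) is the commutator of (0, a) ⊗ (x, 0), and both faces kill this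
tensor. The converse is the heart of the proof (`exists_kerCommutator_eq_arr`): modulo [A, Ker ρ]
the bracket ra - ar depends on r only through ρ(r). Hence the R-component of the commutator of v ∈
𝔑₁ ⊗ 𝔑₁ is a linear function of the difference of the two faces of v, and vanishes if they agree.

In degree 0, the homology of Tot is A modulo ρ(R) and the commutators of A. -/

namespace AlgHomology

noncomputable section

open scoped TensorProduct ZeroObject

/-! ### Homology classes of complexes of vector spaces, on elements -/

section Homology

variable {k : Type u} [Field k]

theorem moduleCat_exact_iff_exact {S : ShortComplex (ModuleCat.{v} k)} :
    S.Exact ↔ Function.Exact S.f.hom S.g.hom := by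
  rw [ShortComplex.moduleCat_exact_iff_range_eq_ker, LinearMap.exact_iff, eq_comm]

variable (K : ChainComplex (ModuleCat.{v} k) ℕ)

theorem iCycles_injective (n : ℕ) : Function.Injective (K.iCycles n).hom :=
  (ModuleCat.mono_iff_injective _).1 inferInstance

theorem homologyπ_surjective (n : ℕ) : Function.Surjective (K.homologyπ n).hom :=
  (ModuleCat.epi_iff_surjective _).1 inferInstance

theorem exists_iCycles_eq {n m : ℕ} (h : (ComplexShape.down ℕ).next n = m) (x : K.X n)
    (hx : (K.d n m).hom x = 0) : ∃ z : K.cycles n, (K.iCycles n).hom z = x := by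
  refine ⟨(K.liftCycles (ModuleCat.ofHom (LinearMap.ker (K.d n m).hom).subtype) m h
    (by ext y; exact y.2)).hom ⟨x, hx⟩, ?_⟩
  exact LinearMap.congr_fun (congrArg ModuleCat.Hom.hom (K.liftCycles_i _ m h _)) _

theorem d_iCycles (n m : ℕ) (z : K.cycles n) : (K.d n m).hom ((K.iCycles n).hom z) = 0 :=
  LinearMap.congr_fun (congrArg ModuleCat.Hom.hom (K.iCycles_d n m)) z

theorem iCycles_toCycles (n m : ℕ) (x : K.X n) :
    (K.iCycles m).hom ((K.toCycles n m).hom x) = (K.d n m).hom x :=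
  LinearMap.congr_fun (congrArg ModuleCat.Hom.hom (K.toCycles_i n m)) x

theorem homologyπ_eq_zero_iff (n : ℕ) (z : K.cycles n) : (K.homologyπ n).hom z = 0 ↔
    ∃ x : K.X (n + 1), (K.d (n + 1) n).hom x = (K.iCycles n).hom z := by
  have h := ShortComplex.exact_of_g_is_cokernel
    (ShortComplex.mk (K.toCycles (n + 1) n) (K.homologyπ n) (by simp))
    (K.homologyIsCokernel (n + 1) n (by simp))
  rw [moduleCat_exact_iff_exact] at h
  refine (h z).trans ⟨?_, ?_⟩
  · rintro ⟨x, rfl⟩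
    exact ⟨x, (iCycles_toCycles K _ _ x).symm⟩
  · rintro ⟨x, hx⟩
    exact ⟨x, iCycles_injective K n ((iCycles_toCycles K _ _ x).trans hx)⟩

variable {K} in
theorem iCycles_cyclesMap {L : ChainComplex (ModuleCat.{v} k) ℕ} (f : K ⟶ L) (n : ℕ)
    (z : K.cycles n) : (L.iCycles n).hom ((HomologicalComplex.cyclesMap f n).hom z) =
      (f.f n).hom ((K.iCycles n).hom z) :=
  LinearMap.congr_fun (congrArg ModuleCat.Hom.hom (HomologicalComplex.cyclesMap_i f n)) z

variable {K} in
theorem homologyMap_homologyπ {L : ChainComplex (ModuleCat.{v} k) ℕ} (f : K ⟶ L) (n : ℕ)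
    (z : K.cycles n) : (HomologicalComplex.homologyMap f n).hom ((K.homologyπ n).hom z) =
      (L.homologyπ n).hom ((HomologicalComplex.cyclesMap f n).hom z) :=
  LinearMap.congr_fun (congrArg ModuleCat.Hom.hom (HomologicalComplex.homologyπ_naturality f n)) z

variable {K} in
theorem hom_f_d {L : ChainComplex (ModuleCat.{v} k) ℕ} (f : K ⟶ L) (n m : ℕ) (x : K.X n) :
    (f.f m).hom ((K.d n m).hom x) = (L.d n m).hom ((f.f n).hom x) :=
  (LinearMap.congr_fun (congrArg ModuleCat.Hom.hom (f.comm n m)) x).symm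

/-- A linear map with values in the range of an injective linear map factors through it. -/
theorem exists_comp_eq_of_injective {Z M N : Type*} [AddCommGroup Z] [AddCommGroup M]
    [AddCommGroup N] [Module k Z] [Module k M] [Module k N] (j : M →ₗ[k] N)
    (hj : Function.Injective j) (φ : Z →ₗ[k] N) (h : ∀ z, ∃ m, j m = φ z) :
    ∃ ψ : Z →ₗ[k] M, ∀ z, j (ψ z) = φ z := by
  refine ⟨(LinearEquiv.ofInjective j hj).symm.toLinearMap ∘ₗ
    φ.codRestrict (LinearMap.range j) h, fun z => ?_⟩
  exact congrArg Subtype.val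
    ((LinearEquiv.ofInjective j hj).apply_symm_apply (φ.codRestrict (LinearMap.range j) h z))

/-- A surjective linear map identifies its target with a quotient. -/
theorem exists_quotient_equiv {Z M : Type*} [AddCommGroup Z] [AddCommGroup M] [Module k Z]
    [Module k M] (ψ : Z →ₗ[k] M) (hψ : Function.Surjective ψ) (W : Submodule k Z)
    (hW : ∀ z, ψ z = 0 ↔ z ∈ W) :
    ∃ e : (Z ⧸ W) ≃ₗ[k] M, ∀ z, e (Submodule.Quotient.mk z) = ψ z := by
  obtain rfl : LinearMap.ker ψ = W := Submodule.ext hW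
  exact ⟨ψ.quotKerEquivOfSurjective hψ, fun z => rfl⟩

/-- `H₀` of a complex as a quotient of the space of `0`-chains. -/
theorem exists_homology_zero_equiv {M Q : Type*} [AddCommGroup M] [AddCommGroup Q]
    [Module k M] [Module k Q] (φ : M →ₗ[k] K.X 0) (hφ : Function.Surjective φ) (c : M →ₗ[k] Q)
    (hc : Function.Surjective c)
    (h : ∀ m, (∃ x : K.X 1, (K.d 1 0).hom x = φ m) ↔ c m = 0) :
    ∃ e : K.homology 0 ≃ₗ[k] Q, ∀ m, IsHomologyClass K 0 (φ m) (e.symm (c m)) := by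
  have hz (x : K.X 0) : ∃ z : K.cycles 0, (K.iCycles 0).hom z = x :=
    exists_iCycles_eq K (m := 0) (by simp) x (by rw [K.shape 0 0 (by simp)]; rfl)
  obtain ⟨ψ, hψ⟩ := exists_comp_eq_of_injective (K.iCycles 0).hom (iCycles_injective K 0) φ
    (fun m => hz (φ m))
  have hψs : Function.Surjective ψ := fun z => by
    obtain ⟨m, hm⟩ := hφ ((K.iCycles 0).hom z)
    exact ⟨m, iCycles_injective K 0 ((hψ m).trans hm)⟩
  obtain ⟨e₁, he₁⟩ := exists_quotient_equiv ((K.homologyπ 0).hom ∘ₗ ψ)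
    ((homologyπ_surjective K 0).comp hψs) (LinearMap.ker c) (fun m => by
      rw [LinearMap.mem_ker, ← h, ← hψ]
      exact homologyπ_eq_zero_iff K 0 (ψ m))
  obtain ⟨e₂, he₂⟩ := exists_quotient_equiv c hc (LinearMap.ker c) (fun m => Iff.rfl)
  refine ⟨e₁.symm.trans e₂, fun m => ⟨ψ m, hψ m, ?_⟩⟩
  rw [LinearEquiv.trans_symm, LinearEquiv.trans_apply, ← he₂, LinearEquiv.symm_apply_apply,
    LinearEquiv.symm_symm, he₁]
  rfl

/-- The end of the long exact homology sequence of a surjective chain map `f : T ⟶ Y`, when the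
first homology of its kernel is presented as `Z ⧸ W` and the zeroth one vanishes. -/
theorem exists_exact_sequence {T Y : ChainComplex (ModuleCat.{v} k) ℕ} (f : T ⟶ Y)
    (hf : ∀ n, Function.Surjective (f.f n).hom) {Z : Type*} [AddCommGroup Z] [Module k Z]
    (φ : Z →ₗ[k] T.X 1) (hφd : ∀ z, (T.d 1 0).hom (φ z) = 0) (hφf : ∀ z, (f.f 1).hom (φ z) = 0)
    (W : Submodule k Z)
    (hW : ∀ z, (∃ t : T.X 2, (f.f 2).hom t = 0 ∧ (T.d 2 1).hom t = φ z) ↔ z ∈ W)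
    (hgen : ∀ t : T.X 1, (T.d 1 0).hom t = 0 → (f.f 1).hom t = 0 →
      ∃ (z : Z) (t₂ : T.X 2), (f.f 2).hom t₂ = 0 ∧ t = φ z + (T.d 2 1).hom t₂)
    (h₀ : ∀ t : T.X 0, (f.f 0).hom t = 0 →
      ∃ t₁ : T.X 1, (f.f 1).hom t₁ = 0 ∧ (T.d 1 0).hom t₁ = t) :
    ∃ (δ : Y.homology 2 →ₗ[k] Z ⧸ W) (β : (Z ⧸ W) →ₗ[k] T.homology 1),
      (∀ z, IsHomologyClass T 1 (φ z) (β (Submodule.Quotient.mk z))) ∧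
      Function.Exact (HomologicalComplex.homologyMap f 2).hom δ ∧ Function.Exact δ β ∧
      Function.Exact β (HomologicalComplex.homologyMap f 1).hom ∧
      Function.Surjective (HomologicalComplex.homologyMap f 1).hom := by
  have hepi : Epi f := by
    have (n : ℕ) : Epi (f.f n) := (ModuleCat.epi_iff_surjective _).2 (hf n)
    exact HomologicalComplex.epi_of_epi_f f this
  -- The short exact sequence 0 → ker f → T → Y → 0. Evaluated in each degree it stays exact, so
  -- chains of the kernel may be treated as chains of T killed by f.
  let S : ShortComplex (ChainComplex (ModuleCat.{v} k) ℕ) :=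
    ShortComplex.mk (Limits.kernel.ι f) f (Limits.kernel.condition f)
  have hS : S.ShortExact :=
    { exact := ShortComplex.exact_of_f_is_kernel S (Limits.kernelIsKernel f)
      mono_f := inferInstanceAs (Mono (Limits.kernel.ι f))
      epi_g := hepi }
  have hSn (n : ℕ) : (S.map (HomologicalComplex.eval _ _ n)).ShortExact :=
    hS.map_of_exact (HomologicalComplex.eval _ _ n)
  have hinj (n : ℕ) : Function.Injective (S.f.f n).hom := (hSn n).moduleCat_injective_f
  have hex (n : ℕ) : Function.Exact (S.f.f n).hom (f.f n).hom :=
    moduleCat_exact_iff_exact.1 (hSn n).exact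
  have hj : Function.Injective ((S.f.f 1).hom ∘ₗ (S.X₁.iCycles 1).hom) :=
    (hinj 1).comp (iCycles_injective S.X₁ 1)
  -- Since `φ z` is a cycle of T killed by f, φ lifts to a linear map ψ from Z to the 1-cycles of
  -- the kernel.
  obtain ⟨ψ, hψ⟩ := exists_comp_eq_of_injective _ hj φ (fun z => by
    obtain ⟨l, hl⟩ := (hex 1 (φ z)).1 (hφf z)
    obtain ⟨c, hc⟩ := exists_iCycles_eq S.X₁ (n := 1) (m := 0) (by simp) l (hinj 0 (by
      rw [hom_f_d S.f, hl, map_zero]; exact hφd z))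
    exact ⟨c, (congrArg _ hc).trans hl⟩)
  -- e identifies `Z ⧸ W` with the first homology of the kernel: `hgen` shows that ψ hits every
  -- class, and `hW` that exactly W goes to boundaries.
  obtain ⟨e, he⟩ := exists_quotient_equiv ((S.X₁.homologyπ 1).hom ∘ₗ ψ) (fun h => by
    obtain ⟨c, rfl⟩ := homologyπ_surjective S.X₁ 1 h
    obtain ⟨z, t₂, ht₂, h⟩ := hgen ((S.f.f 1).hom ((S.X₁.iCycles 1).hom c))
      (by
        refine (hom_f_d S.f 1 0 _).symm.trans ?_
        rw [d_iCycles, map_zero])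
      ((hex 1 _).2 ⟨_, rfl⟩)
    obtain ⟨l₂, rfl⟩ := (hex 2 t₂).1 ht₂
    refine ⟨z, ?_⟩
    rw [LinearMap.comp_apply, ← sub_eq_zero, ← map_sub, homologyπ_eq_zero_iff]
    refine ⟨-l₂, hinj 1 ?_⟩
    have h' := hψ z
    rw [LinearMap.comp_apply] at h'
    rw [map_sub, map_sub, h', h, map_neg, map_neg, hom_f_d S.f]
    abel) W (fun z => by
      rw [← hW, LinearMap.comp_apply, homologyπ_eq_zero_iff]
      constructor
      · rintro ⟨l, hl⟩
        refine ⟨(S.f.f 2).hom l, (hex 2 _).2 ⟨_, rfl⟩, ?_⟩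
        rw [← hψ, LinearMap.comp_apply, ← hl]
        exact (hom_f_d S.f 2 1 l).symm
      · rintro ⟨t, ht, h⟩
        obtain ⟨l, rfl⟩ := (hex 2 t).1 ht
        refine ⟨l, hinj 1 ?_⟩
        rw [hom_f_d S.f]
        exact h.trans (hψ z).symm)
  have E₃ := moduleCat_exact_iff_exact.1 (hS.homology_exact₃ 2 1 rfl)
  have E₁ := moduleCat_exact_iff_exact.1 (hS.homology_exact₁ 2 1 rfl)
  have E₂ := moduleCat_exact_iff_exact.1 (hS.homology_exact₂ 1)
  -- δ is the connecting map and β is induced by the inclusion of the kernel, both transported along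
  -- e.
  refine ⟨e.symm.toLinearMap ∘ₗ (hS.δ 2 1 rfl).hom,
    (HomologicalComplex.homologyMap S.f 1).hom ∘ₗ e.toLinearMap, fun z => ?_, ?_, ?_, ?_, ?_⟩
  · refine ⟨(HomologicalComplex.cyclesMap S.f 1).hom (ψ z), ?_, ?_⟩
    · exact (iCycles_cyclesMap S.f 1 (ψ z)).trans (hψ z)
    · refine (homologyMap_homologyπ S.f 1 (ψ z)).symm.trans ?_
      rw [LinearMap.comp_apply, LinearEquiv.coe_coe, he]
      rfl
  · intro y
    rw [LinearMap.comp_apply, LinearEquiv.coe_coe, LinearEquiv.map_eq_zero_iff]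
    exact E₃ y
  · intro z
    refine (E₁ (e z)).trans ⟨?_, ?_⟩
    · rintro ⟨y, hy⟩
      exact ⟨y, e.injective ((e.apply_symm_apply _).trans hy)⟩
    · rintro ⟨y, rfl⟩
      exact ⟨y, (e.apply_symm_apply _).symm⟩
  · intro y
    refine (E₂ y).trans ⟨?_, ?_⟩
    · rintro ⟨x, rfl⟩
      exact ⟨e.symm x, congrArg _ (e.apply_symm_apply x)⟩
    · rintro ⟨x, rfl⟩
      exact ⟨e x, rfl⟩
  · intro h
    obtain ⟨y, rfl⟩ := homologyπ_surjective Y 1 h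
    -- A lift t of a cycle of Y has its boundary in the kernel. By `h₀` this is the boundary of some
    -- t₁ in the kernel, and t - t₁ is a cycle lifting the same element.
    obtain ⟨t, ht⟩ := hf 1 ((Y.iCycles 1).hom y)
    obtain ⟨t₁, ht₁, hd⟩ := h₀ ((T.d 1 0).hom t) (by rw [hom_f_d, ht, d_iCycles])
    obtain ⟨c, hc⟩ := exists_iCycles_eq T (n := 1) (m := 0) (by simp) (t - t₁) (by
      rw [map_sub, hd, sub_self])
    refine ⟨(T.homologyπ 1).hom c, (homologyMap_homologyπ f 1 c).trans (congrArg _ ?_)⟩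
    refine iCycles_injective Y 1 ((iCycles_cyclesMap f 1 c).trans ?_)
    rw [hc, map_sub, ht₁, ht, sub_zero]

end Homology

/-! ### Total complexes of first quadrant bicomplexes, spot by spot -/

section TotalComplex

variable {k : Type u} [Field k]
  (K : HomologicalComplex₂ (ModuleCat.{v} k) (ComplexShape.down ℕ) (ComplexShape.down ℕ))

/-- The inclusion of the `(p, q)` spot of a bicomplex in the total complex, as a linear map. -/
def totalIncl (p q n : ℕ) (h : p + q = n) :
    (K.X p).X q →ₗ[k] (K.total (ComplexShape.down ℕ)).X n :=
  (K.ιTotal (ComplexShape.down ℕ) p q n h).hom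

/-- The projection of the total complex of a bicomplex to its `(p, q)` spot. -/
def totalProj (p q n : ℕ) (h : p + q = n) :
    (K.total (ComplexShape.down ℕ)).X n →ₗ[k] (K.X p).X q :=
  (K.totalDesc (fun p' q' (h' : p' + q' = n) => if hp : p' = p then
    (K.XXIsoOfEq _ _ _ hp (by omega : q' = q)).hom else 0)).hom

theorem totalProj_totalIncl (p q n : ℕ) (h : p + q = n) (x : (K.X p).X q) :
    totalProj K p q n h (totalIncl K p q n h x) = x := by
  have := K.ι_totalDesc (c₁₂ := ComplexShape.down ℕ) (fun p' q' (h' : p' + q' = n) =>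
    if hp : p' = p then (K.XXIsoOfEq _ _ _ hp (by omega : q' = q)).hom else 0) p q h
  rw [dif_pos rfl] at this
  exact LinearMap.congr_fun (congrArg ModuleCat.Hom.hom this) x

theorem totalProj_totalIncl_of_ne (p q p' q' n : ℕ) (h : p + q = n) (h' : p' + q' = n)
    (hp : p' ≠ p) (x : (K.X p').X q') :
    totalProj K p q n h (totalIncl K p' q' n h' x) = 0 := by
  have := K.ι_totalDesc (c₁₂ := ComplexShape.down ℕ) (fun p' q' (h' : p' + q' = n) =>
    if hp : p' = p then (K.XXIsoOfEq _ _ _ hp (by omega : q' = q)).hom else 0) p' q' h'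
  rw [dif_neg hp] at this
  exact LinearMap.congr_fun (congrArg ModuleCat.Hom.hom this) x

theorem totalIncl_injective (p q n : ℕ) (h : p + q = n) :
    Function.Injective (totalIncl K p q n h) :=
  Function.LeftInverse.injective (totalProj_totalIncl K p q n h)

variable {K} in
theorem total_hom_ext {n : ℕ} {M : Type v} [AddCommGroup M] [Module k M]
    {f g : (K.total (ComplexShape.down ℕ)).X n →ₗ[k] M}
    (h : ∀ p q (hpq : p + q = n) x, f (totalIncl K p q n hpq x) = g (totalIncl K p q n hpq x)) :
    f = g := by
  have : ModuleCat.ofHom f = (ModuleCat.ofHom g : (K.total (ComplexShape.down ℕ)).X n ⟶ _) :=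
    HomologicalComplex₂.total.hom_ext _ fun p q hpq => by
      ext x
      exact h p q hpq x
  exact congrArg ModuleCat.Hom.hom this

/-- An element of the total complex is the sum of its components. -/
theorem sum_totalIncl_totalProj (n : ℕ) (x : (K.total (ComplexShape.down ℕ)).X n) :
    ∑ p : Fin (n + 1), totalIncl K p (n - p) n (by omega)
      (totalProj K p (n - p) n (by omega) x) = x := by
  have : ∑ p : Fin (n + 1), totalIncl K p (n - p) n (by omega) ∘ₗ
      totalProj K p (n - p) n (by omega) = LinearMap.id := by
    refine total_hom_ext fun p q hpq x => ?_
    rw [LinearMap.sum_apply, Finset.sum_eq_single ⟨p, by omega⟩]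
    · obtain rfl : q = n - p := by omega
      rw [LinearMap.comp_apply, totalProj_totalIncl]
      rfl
    · intro p' _ hp'
      rw [LinearMap.comp_apply, totalProj_totalIncl_of_ne _ _ _ _ _ _ _ _
        (fun h => hp' (Fin.ext h.symm)), map_zero]
    · simp
  have h := LinearMap.congr_fun this x
  rwa [LinearMap.sum_apply] at h

theorem exists_totalIncl_zero (x : (K.total (ComplexShape.down ℕ)).X 0) :
    ∃ y, x = totalIncl K 0 0 0 rfl y :=
  ⟨_, (sum_totalIncl_totalProj K 0 x).symm.trans (by rw [Fin.sum_univ_one]; rfl)⟩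

theorem exists_totalIncl_one (x : (K.total (ComplexShape.down ℕ)).X 1) :
    ∃ y z, x = totalIncl K 0 1 1 rfl y + totalIncl K 1 0 1 rfl z :=
  ⟨_, _, (sum_totalIncl_totalProj K 1 x).symm.trans (by rw [Fin.sum_univ_two]; rfl)⟩

theorem exists_totalIncl_two (x : (K.total (ComplexShape.down ℕ)).X 2) :
    ∃ y z w, x = totalIncl K 0 2 2 rfl y + totalIncl K 1 1 2 rfl z + totalIncl K 2 0 2 rfl w :=
  ⟨_, _, _, (sum_totalIncl_totalProj K 2 x).symm.trans (by rw [Fin.sum_univ_three]; rfl)⟩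

/-- No horizontal differential leaves column 0, and its vertical differential has sign (-1)⁰. -/
theorem total_d_totalIncl_zero (q : ℕ) (x : (K.X 0).X (q + 1)) :
    ((K.total (ComplexShape.down ℕ)).d (q + 1) q).hom
      (totalIncl K 0 (q + 1) (q + 1) (Nat.zero_add _) x) =
    totalIncl K 0 q q (Nat.zero_add _) (((K.X 0).d (q + 1) q).hom x) := by
  have : K.ιTotal (ComplexShape.down ℕ) 0 (q + 1) (q + 1) (Nat.zero_add _) ≫
      (K.total (ComplexShape.down ℕ)).d (q + 1) q =
      (K.X 0).d (q + 1) q ≫ K.ιTotal (ComplexShape.down ℕ) 0 q q (Nat.zero_add _) := by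
    rw [HomologicalComplex₂.total_d, Preadditive.comp_add, HomologicalComplex₂.ι_D₁,
      HomologicalComplex₂.ι_D₂, HomologicalComplex₂.d₁_eq_zero K _ 0 _ _ (by simp), zero_add,
      HomologicalComplex₂.d₂_eq K (ComplexShape.down ℕ) 0 (i₂' := q) rfl q (Nat.zero_add q)]
    exact one_smul ℤˣ _
  exact LinearMap.congr_fun (congrArg ModuleCat.Hom.hom this) x

/-- No vertical differential leaves height 0, and horizontal differentials carry no sign. -/
theorem total_d_totalIncl_succ_zero (p : ℕ) (x : (K.X (p + 1)).X 0) :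
    ((K.total (ComplexShape.down ℕ)).d (p + 1) p).hom (totalIncl K (p + 1) 0 (p + 1) rfl x) =
    totalIncl K p 0 p rfl (((K.d (p + 1) p).f 0).hom x) := by
  have : K.ιTotal (ComplexShape.down ℕ) (p + 1) 0 (p + 1) rfl ≫
      (K.total (ComplexShape.down ℕ)).d (p + 1) p =
      (K.d (p + 1) p).f 0 ≫ K.ιTotal (ComplexShape.down ℕ) p 0 p rfl := by
    rw [HomologicalComplex₂.total_d, Preadditive.comp_add, HomologicalComplex₂.ι_D₁,
      HomologicalComplex₂.ι_D₂, HomologicalComplex₂.d₂_eq_zero K _ _ 0 _ (by simp), add_zero,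
      HomologicalComplex₂.d₁_eq K (ComplexShape.down ℕ) (i₁' := p) rfl 0 p rfl]
    exact one_smul ℤˣ _
  exact LinearMap.congr_fun (congrArg ModuleCat.Hom.hom this) x

/-- The minus sign is the factor (-1)ᵖ of the vertical differential at p = 1. This formula serves to
trade an entry of column 0 in the horizontal image for one of column 1, modulo boundaries. -/
theorem total_d_totalIncl_one_succ (q : ℕ) (x : (K.X 1).X (q + 1)) :
    ((K.total (ComplexShape.down ℕ)).d (q + 2) (q + 1)).hom
      (totalIncl K 1 (q + 1) (q + 2) (by omega) x) =
    totalIncl K 0 (q + 1) (q + 1) (by omega) (((K.d 1 0).f (q + 1)).hom x) -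
      totalIncl K 1 q (q + 1) (by omega) (((K.X 1).d (q + 1) q).hom x) := by
  have : K.ιTotal (ComplexShape.down ℕ) 1 (q + 1) (q + 2) (by change 1 + (q + 1) = _; omega) ≫
      (K.total (ComplexShape.down ℕ)).d (q + 2) (q + 1) =
      (K.d 1 0).f (q + 1) ≫ K.ιTotal (ComplexShape.down ℕ) 0 (q + 1) (q + 1)
        (by change 0 + (q + 1) = _; omega) -
      (K.X 1).d (q + 1) q ≫ K.ιTotal (ComplexShape.down ℕ) 1 q (q + 1)
        (by change 1 + q = _; omega) := by
    rw [HomologicalComplex₂.total_d, Preadditive.comp_add, HomologicalComplex₂.ι_D₁,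
      HomologicalComplex₂.ι_D₂, HomologicalComplex₂.d₂_eq K (ComplexShape.down ℕ) 1 (i₂' := q) rfl
        (q + 1) (by change 1 + q = _; omega),
      HomologicalComplex₂.d₁_eq K (ComplexShape.down ℕ) (i₁ := 1) (i₁' := 0) rfl (q + 1) (q + 1)
        (by change 0 + (q + 1) = _; omega), sub_eq_add_neg]
    congr 1
    · exact one_smul ℤˣ _
    · have : ComplexShape.ε₂ (ComplexShape.down ℕ) (ComplexShape.down ℕ) (ComplexShape.down ℕ)
          (1, q + 1) = -1 := by
        change ((-1 : ℤˣ)) ^ _ = _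
        simp
      rw [this, Units.neg_smul, one_smul]
  exact LinearMap.congr_fun (congrArg ModuleCat.Hom.hom this) x

theorem totalAugmentation_totalIncl_zero (Y : ChainComplex (ModuleCat.{v} k) ℕ) (e : K.X 0 ⟶ Y)
    (he : K.d 1 0 ≫ e = 0) (n : ℕ) (x : (K.X 0).X n) :
    ((totalAugmentation K Y e he).f n).hom (totalIncl K 0 n n (Nat.zero_add n) x) =
      (e.f n).hom x := by
  have := K.ι_totalDesc (c₁₂ := ComplexShape.down ℕ)
    (fun p q (h : p + q = n) => augmentationComponent K Y e p q n h) 0 n (Nat.zero_add n)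
  rw [augmentationComponent_zero] at this
  exact LinearMap.congr_fun (congrArg ModuleCat.Hom.hom this) x

theorem totalAugmentation_totalIncl_succ (Y : ChainComplex (ModuleCat.{v} k) ℕ) (e : K.X 0 ⟶ Y)
    (he : K.d 1 0 ≫ e = 0) (p q n : ℕ) (h : p + 1 + q = n) (x : (K.X (p + 1)).X q) :
    ((totalAugmentation K Y e he).f n).hom (totalIncl K (p + 1) q n h x) = 0 := by
  have := K.ι_totalDesc (c₁₂ := ComplexShape.down ℕ)
    (fun p q (h : p + q = n) => augmentationComponent K Y e p q n h) (p + 1) q h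
  exact LinearMap.congr_fun (congrArg ModuleCat.Hom.hom this) x

/-- The exact sequence relating the homology of the total complex of a bicomplex to the homology
of an augmentation `Y`, when the augmented rows are exact in the columns of index `0` and `-1`. -/
theorem exists_exact_sequence_totalAugmentation (Y : ChainComplex (ModuleCat.{v} k) ℕ)
    (e : K.X 0 ⟶ Y) (he : K.d 1 0 ≫ e = 0) (hsurj : ∀ n, Function.Surjective (e.f n).hom)
    (hexact : ∀ n x, (e.f n).hom x = 0 → ∃ y, ((K.d 1 0).f n).hom y = x)
    {Z : Type*} [AddCommGroup Z] [Module k Z] (φ : Z →ₗ[k] (K.X 1).X 0)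
    (hφ : ∀ z, ((K.d 1 0).f 0).hom (φ z) = 0)
    (hgen : ∀ x, ((K.d 1 0).f 0).hom x = 0 → ∃ z y, x = φ z + ((K.d 2 1).f 0).hom y)
    (W : Submodule k Z)
    (hW : ∀ z, z ∈ W ↔ ∃ x y, ((K.d 1 0).f 1).hom y = 0 ∧
      ((K.d 2 1).f 0).hom x - ((K.X 1).d 1 0).hom y = φ z) :
    ∃ (δ : Y.homology 2 →ₗ[k] Z ⧸ W)
      (β : (Z ⧸ W) →ₗ[k] (K.total (ComplexShape.down ℕ)).homology 1),
      (∀ z, IsHomologyClass (K.total (ComplexShape.down ℕ)) 1 (totalIncl K 1 0 1 rfl (φ z))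
        (β (Submodule.Quotient.mk z))) ∧
      Function.Exact (HomologicalComplex.homologyMap (totalAugmentation K Y e he) 2).hom δ ∧
      Function.Exact δ β ∧
      Function.Exact β (HomologicalComplex.homologyMap (totalAugmentation K Y e he) 1).hom ∧
      Function.Surjective (HomologicalComplex.homologyMap (totalAugmentation K Y e he) 1).hom := by
  have hf0 := totalAugmentation_totalIncl_zero K Y e he
  have hf1 := totalAugmentation_totalIncl_succ K Y e he
  refine exists_exact_sequence (totalAugmentation K Y e he) (fun n y => ?_)
    (totalIncl K 1 0 1 rfl ∘ₗ φ) (fun z => ?_) (fun z => hf1 0 0 1 rfl _) W (fun z => ?_) ?_ ?_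
  · obtain ⟨x, rfl⟩ := hsurj n y
    exact ⟨_, hf0 n x⟩
  · rw [LinearMap.comp_apply, total_d_totalIncl_succ_zero, hφ, map_zero]
  · rw [hW]
    constructor
    · rintro ⟨t, ht, hd⟩
      obtain ⟨y, z', w, rfl⟩ := exists_totalIncl_two K t
      rw [map_add, map_add, hf0, hf1 0 1 2, hf1 1 0 2, add_zero, add_zero] at ht
      -- The entry at (0, 2) is killed by the augmentation, so it is a horizontal image. Adjusting
      -- by a boundary from the spot (1, 2) moves it to (1, 1), where it becomes the vertical
      -- differential of y.
      obtain ⟨y, rfl⟩ := hexact 2 y ht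
      have hdd : ((K.total (ComplexShape.down ℕ)).d 2 1).hom
          (totalIncl K 0 2 2 rfl (((K.d 1 0).f 2).hom y) -
            totalIncl K 1 1 2 rfl (((K.X 1).d 2 1).hom y)) = 0 := by
        rw [← total_d_totalIncl_one_succ K 1 y]
        exact LinearMap.congr_fun (congrArg ModuleCat.Hom.hom
          ((K.total (ComplexShape.down ℕ)).d_comp_d 3 2 1)) _
      rw [map_sub, sub_eq_zero] at hdd
      rw [map_add, map_add, hdd, ← map_add, ← map_add (totalIncl K 1 1 2 rfl),
        total_d_totalIncl_one_succ K 0,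
        total_d_totalIncl_succ_zero K 1, LinearMap.comp_apply] at hd
      refine ⟨w, ((K.X 1).d 2 1).hom y + z', ?_, ?_⟩
      rotate_left 1
      -- The component of `hd` at (1, 0) is the required equation. The one at (0, 1) says that the
      -- new entry at (1, 1) is killed horizontally.
      · have := congrArg (totalProj K 1 0 1 rfl) hd
        rwa [map_add, map_sub, totalProj_totalIncl, totalProj_totalIncl, totalProj_totalIncl,
          totalProj_totalIncl_of_ne _ _ _ _ _ _ _ _ (by simp), zero_sub, neg_add_eq_sub] at this
      · have := congrArg (totalProj K 0 1 1 rfl) hd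
        rwa [map_add, map_sub, totalProj_totalIncl,
          totalProj_totalIncl_of_ne _ _ _ _ _ _ _ _ (by simp),
          totalProj_totalIncl_of_ne _ _ _ _ _ _ _ _ (by simp),
          totalProj_totalIncl_of_ne _ _ _ _ _ _ _ _ (by simp), sub_zero, add_zero] at this
    · rintro ⟨x, y, hy, h⟩
      refine ⟨totalIncl K 1 1 2 rfl y + totalIncl K 2 0 2 rfl x, ?_, ?_⟩
      · rw [map_add, hf1 0 1 2, hf1 1 0 2, add_zero]
      · rw [map_add, total_d_totalIncl_one_succ K 0, total_d_totalIncl_succ_zero K 1, hy, map_zero,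
          LinearMap.comp_apply, ← h, map_sub]
        abel
  · intro t hd ht
    obtain ⟨y, x, rfl⟩ := exists_totalIncl_one K t
    rw [map_add, hf0, hf1 0 0 1, add_zero] at ht
    obtain ⟨y, rfl⟩ := hexact 1 y ht
    -- The same move one degree lower: modulo the boundary of y placed at (1, 1), the chain t is
    -- concentrated at (1, 0). There, being a cycle means being killed by the horizontal
    -- differential, so `hgen` applies.
    have hdd := total_d_totalIncl_one_succ K 0 y
    have hd' : ((K.total (ComplexShape.down ℕ)).d 1 0).hom
        (((K.total (ComplexShape.down ℕ)).d 2 1).hom (totalIncl K 1 1 2 rfl y)) = 0 :=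
      LinearMap.congr_fun (congrArg ModuleCat.Hom.hom
        ((K.total (ComplexShape.down ℕ)).d_comp_d 2 1 0)) _
    rw [eq_sub_iff_add_eq] at hdd
    rw [← hdd, map_add, map_add, hd', zero_add, ← map_add, ← map_add,
      total_d_totalIncl_succ_zero K 0] at hd
    obtain ⟨z, w, hz⟩ := hgen _ (totalIncl_injective K 0 0 0 rfl (hd.trans (map_zero _).symm))
    refine ⟨z, totalIncl K 1 1 2 rfl y + totalIncl K 2 0 2 rfl w, ?_, ?_⟩
    · rw [map_add, hf1 0 1 2, hf1 1 0 2, add_zero]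
    · rw [← hdd, add_assoc, ← map_add (totalIncl K 1 0 1 rfl), hz, map_add, map_add,
        LinearMap.comp_apply, total_d_totalIncl_succ_zero K 1]
      abel
  · intro t ht
    obtain ⟨y, rfl⟩ := exists_totalIncl_zero K t
    rw [hf0] at ht
    obtain ⟨x, rfl⟩ := hexact 0 y ht
    exact ⟨totalIncl K 1 0 1 rfl x, hf1 0 0 1 rfl x, total_d_totalIncl_succ_zero K 0 x⟩

theorem exists_total_d_one_zero_iff (m : (K.X 0).X 0) :
    (∃ x, ((K.total (ComplexShape.down ℕ)).d 1 0).hom x = totalIncl K 0 0 0 rfl m) ↔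
      ∃ x y, ((K.d 1 0).f 0).hom x + ((K.X 0).d 1 0).hom y = m := by
  constructor
  · rintro ⟨t, ht⟩
    obtain ⟨y, x, rfl⟩ := exists_totalIncl_one K t
    rw [map_add, total_d_totalIncl_zero K 0, total_d_totalIncl_succ_zero K 0, ← map_add] at ht
    exact ⟨x, y, (add_comm _ _).trans (totalIncl_injective K 0 0 0 rfl ht)⟩
  · rintro ⟨x, y, rfl⟩
    refine ⟨totalIncl K 0 1 1 rfl y + totalIncl K 1 0 1 rfl x, ?_⟩
    rw [map_add, total_d_totalIncl_zero K 0, total_d_totalIncl_succ_zero K 0, ← map_add, add_comm]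

variable {K} in
theorem total_map_totalIncl
    {L : HomologicalComplex₂ (ModuleCat.{v} k) (ComplexShape.down ℕ) (ComplexShape.down ℕ)}
    (f : K ⟶ L) (p q n : ℕ) (h : p + q = n) (x : (K.X p).X q) :
    ((HomologicalComplex₂.total.map f (ComplexShape.down ℕ)).f n).hom (totalIncl K p q n h x) =
      totalIncl L p q n h (((f.f p).f q).hom x) :=
  LinearMap.congr_fun (congrArg ModuleCat.Hom.hom
    (HomologicalComplex₂.ιTotal_map K L f (ComplexShape.down ℕ) p q n h)) x

variable {K} in
theorem totalProj_total_map
    {L : HomologicalComplex₂ (ModuleCat.{v} k) (ComplexShape.down ℕ) (ComplexShape.down ℕ)}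
    (f : K ⟶ L) (p q n : ℕ) (h : p + q = n) (x : (K.total (ComplexShape.down ℕ)).X n) :
    totalProj L p q n h (((HomologicalComplex₂.total.map f (ComplexShape.down ℕ)).f n).hom x) =
      ((f.f p).f q).hom (totalProj K p q n h x) := by
  have : totalProj L p q n h ∘ₗ ((HomologicalComplex₂.total.map f (ComplexShape.down ℕ)).f n).hom =
      ((f.f p).f q).hom ∘ₗ totalProj K p q n h := by
    refine total_hom_ext fun p' q' h' x => ?_
    rw [LinearMap.comp_apply, LinearMap.comp_apply, total_map_totalIncl]
    by_cases hp : p' = p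
    · subst hp
      obtain rfl : q = q' := by omega
      rw [totalProj_totalIncl, totalProj_totalIncl]
    · rw [totalProj_totalIncl_of_ne _ _ _ _ _ _ _ _ hp,
        totalProj_totalIncl_of_ne _ _ _ _ _ _ _ _ hp, map_zero]
  exact LinearMap.congr_fun this x

end TotalComplex

/-! ### Chains of degree 0 and 1 and the commutator map -/

section LowDegree

variable {k : Type u} [Field k]

/-- The linear map on a two-fold tensor power given by a bilinear map. -/
theorem exists_lift_two {M N : Type*} [AddCommGroup M] [AddCommGroup N] [Module k M] [Module k N]
    (B : M →ₗ[k] M →ₗ[k] N) :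
    ∃ F : (⨂[k] (_ : Fin 2), M) →ₗ[k] N, ∀ g, F (PiTensorProduct.tprod k g) = B (g 0) (g 1) := by
  refine ⟨PiTensorProduct.lift (MultilinearMap.mk' (fun g : Fin 2 → M => B (g 0) (g 1)) ?_ ?_),
    fun g => PiTensorProduct.lift.tprod g⟩
  · intro g i x y
    fin_cases i <;> simp
  · intro g i c x
    fin_cases i <;> simp

variable (k) (B : Type v) [NonUnitalRing B] [Module k B] [IsScalarTower k B B]
  [SMulCommClass k B B]

/-- The commutator `a₀ ⊗ a₁ ↦ a₀a₁ - a₁a₀`, as a map `B^{⊗2} → B`. -/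
def commutatorMap : HochschildChains k B 1 →ₗ[k] B :=
  (PiTensorProduct.subsingletonEquiv (0 : Fin 1)).toLinearMap ∘ₗ hochschildD k B 0

variable {B} in
theorem commutatorMap_tprod (g : Fin 2 → B) :
    commutatorMap k B (PiTensorProduct.tprod k g) = g 0 * g 1 - g 1 * g 0 := by
  have h : hochschildD k B 0 = mulAt k B 0 0 - mulAt k B 0 0 ∘ₗ rotate k B 1 := by
    have hb : barD k B 0 = mulAt k B 0 0 := by simp [barD]
    rw [hochschildD, hb, sub_eq_add_neg]
    refine congrArg _ ?_
    change (-1 : k) ^ 1 • (mulAt k B 0 0 ∘ₗ rotate k B 1) = _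
    rw [pow_one]
    exact neg_one_smul k (mulAt k B 0 0 ∘ₗ rotate k B 1)
  rw [commutatorMap, h, LinearMap.comp_apply, LinearMap.sub_apply, LinearMap.comp_apply,
    rotate_tprod, mulAt_tprod, mulAt_tprod, map_sub]
  simp only [LinearEquiv.coe_coe, PiTensorProduct.subsingletonEquiv_apply_tprod]
  rfl

theorem tprod_commutatorMap (x : HochschildChains k B 1) :
    PiTensorProduct.tprod k (fun _ : Fin 1 => commutatorMap k B x) = hochschildD k B 0 x :=
  (PiTensorProduct.subsingletonEquiv_symm_apply' (0 : Fin 1) _).symm.trans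
    ((PiTensorProduct.subsingletonEquiv (R := k) (s := fun _ => B) (0 : Fin 1)).symm_apply_apply
      (hochschildD k B 0 x))

set_option linter.unusedSectionVars false in
variable {B} in
/-- Equality of linear maps on the chains of degree one is tested on pure tensors. -/
theorem linearMap_ext_chains_one {N : Type*} [AddCommGroup N] [Module k N]
    {f g : HochschildChains k B 1 →ₗ[k] N}
    (h : ∀ a, f (PiTensorProduct.tprod k a) = g (PiTensorProduct.tprod k a)) : f = g :=
  PiTensorProduct.ext (MultilinearMap.ext h)

variable {k}

/-- The degrees `0` and `1` of a functorial complex `Φ`, described by Hochschild chains. -/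
structure LowDegreeChains
    (Φ : NonUnitalAlgCat.{u, v} k ⥤ ChainComplex (ModuleCat.{max u v} k) ℕ) where
  /-- the identification of `B` with the `0`-chains -/
  incl₀ : ∀ B : NonUnitalAlgCat.{u, v} k, B.carrier →ₗ[k] (Φ.obj B).X 0
  bijective_incl₀ : ∀ B, Function.Bijective (incl₀ B)
  map_incl₀ : ∀ {B B' : NonUnitalAlgCat.{u, v} k} (f : B.carrier →ₙₐ[k] B'.carrier) (x : B.carrier),
    ((Φ.map (Y := B') f).f 0).hom (incl₀ B x) = incl₀ B' (f x)
  /-- the inclusion of `B ⊗ B` in the `1`-chains -/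
  incl₁ : ∀ B : NonUnitalAlgCat.{u, v} k, HochschildChains k B.carrier 1 →ₗ[k] (Φ.obj B).X 1
  map_incl₁ : ∀ {B B' : NonUnitalAlgCat.{u, v} k} (f : B.carrier →ₙₐ[k] B'.carrier)
    (x : HochschildChains k B.carrier 1),
    ((Φ.map (Y := B') f).f 1).hom (incl₁ B x) = incl₁ B' (chainsMap f 1 x)
  d_incl₁ : ∀ B x, ((Φ.obj B).d 1 0).hom (incl₁ B x) = incl₀ B (commutatorMap k B.carrier x)
  /-- the projection of the `1`-chains to `B ⊗ B` -/
  proj₁ : ∀ B : NonUnitalAlgCat.{u, v} k, (Φ.obj B).X 1 →ₗ[k] HochschildChains k B.carrier 1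
  proj₁_map : ∀ {B B' : NonUnitalAlgCat.{u, v} k} (f : B.carrier →ₙₐ[k] B'.carrier)
    (x : (Φ.obj B).X 1),
    proj₁ B' (((Φ.map (Y := B') f).f 1).hom x) = chainsMap f 1 (proj₁ B x)
  d_eq : ∀ B x, ((Φ.obj B).d 1 0).hom x = incl₀ B (commutatorMap k B.carrier (proj₁ B x))

end LowDegree

/-! ### Faces of simplices of dimension 1 and 2 -/

namespace AlgCrossedModule

variable {k : Type u} [Field k] {R A : Type v}
  [NonUnitalRing R] [Module k R] [IsScalarTower k R R] [SMulCommClass k R R]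
  [NonUnitalRing A] [Module k A] [IsScalarTower k A A] [SMulCommClass k A A]
  (X : AlgCrossedModule k R A)

/-- The face `dᵢ` of the nerve. -/
def face {n : ℕ} (i : Fin (n + 2)) : X.NerveObj (n + 1) →ₙₐ[k] X.NerveObj n := X.nerve.δ i

theorem face_src {n : ℕ} (i : Fin (n + 2)) (x : X.NerveObj (n + 1)) :
    (X.face i x).src = X.ρ (x.tail (i.succAbove (Fin.last n))) + x.src :=
  NerveObj.comapFun_src _ x

theorem face_arr {n : ℕ} (i : Fin (n + 2)) (x : X.NerveObj (n + 1)) (j : Fin n) :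
    (X.face i x).arr j = x.tail (i.succAbove j.castSucc) - x.tail (i.succAbove j.succ) :=
  NerveObj.comapFun_arr _ x j

variable {X}

theorem NerveObj.ext_zero {x y : X.NerveObj 0} (h : x.src = y.src) : x = y :=
  Prod.ext (funext fun j => j.elim0) h

theorem NerveObj.ext_one {x y : X.NerveObj 1} (h : x.arr 0 = y.arr 0) (h' : x.src = y.src) :
    x = y :=
  Prod.ext (funext fun j => by obtain rfl : j = 0 := Subsingleton.elim _ _; exact h) h'

theorem NerveObj.tail_one_zero (x : X.NerveObj 1) : x.tail 0 = x.arr 0 := by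
  rw [← Fin.castSucc_zero, NerveObj.tail_castSucc]
  exact (congrArg _ x.tail_last).trans (add_zero _)

theorem NerveObj.tail_one_one (x : X.NerveObj 1) : x.tail 1 = 0 := x.tail_last

theorem NerveObj.tail_two_one (x : X.NerveObj 2) : x.tail 1 = x.arr 1 :=
  (x.tail_castSucc 1).trans ((congrArg _ x.tail_last).trans (add_zero _))

/-- The last vertex of a 1-simplex is its source, so for n = 1 the product of the nerve is that of R
⋊ A. -/
theorem NerveObj.mul_arr_one (x y : X.NerveObj 1) : (x * y).arr 0 =
    x.arr 0 * y.arr 0 + X.lact x.src (y.arr 0) + X.ract (x.arr 0) y.src := by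
  have h (z : X.NerveObj 1) : z.vertex (Fin.succ 0) = z.src := by
    rw [NerveObj.vertex]
    exact (congrArg (X.ρ · + z.src) z.tail_last).trans (by rw [map_zero, zero_add])
  rw [NerveObj.mul_arr, h, h]

variable (X)

theorem face_zero_src_one (x : X.NerveObj 1) : (X.face 0 x).src = x.src := by
  rw [face_src]
  exact (congrArg (X.ρ · + x.src) x.tail_one_one).trans (by rw [map_zero, zero_add])

theorem face_one_src_one (x : X.NerveObj 1) : (X.face 1 x).src = X.ρ (x.arr 0) + x.src := by
  rw [face_src]
  exact congrArg (X.ρ · + x.src) x.tail_one_zero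

/-- The `1`-simplex `(0, a)` of the nerve. -/
def identityArrow (a : A) : X.NerveObj 1 := (fun _ => 0, a)

/-- The alternating sum of the faces of a `2`-simplex. -/
theorem face_two_alternating (x : X.NerveObj 2) :
    X.face 0 x - X.face 1 x + X.face 2 x = X.identityArrow (X.ρ (x.arr 1) + x.src) := by
  -- The faces of (r₁, r₂, a) are (r₂, a), (r₁ + r₂, a) and (r₁, ρ(r₂) + a). In the alternating sum
  -- the R-components cancel, and of the A-components the last one survives.
  have h0 : (X.face (0 : Fin 3) x).arr 0 = x.tail 1 - x.tail 2 := X.face_arr 0 x 0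
  have h1 : (X.face (1 : Fin 3) x).arr 0 = x.tail 0 - x.tail 2 := X.face_arr 1 x 0
  have h2 : (X.face (2 : Fin 3) x).arr 0 = x.tail 0 - x.tail 1 := X.face_arr 2 x 0
  have k0 : (X.face (0 : Fin 3) x).src = X.ρ (x.tail 2) + x.src := X.face_src 0 x
  have k1 : (X.face (1 : Fin 3) x).src = X.ρ (x.tail 2) + x.src := X.face_src 1 x
  have k2 : (X.face (2 : Fin 3) x).src = X.ρ (x.tail 1) + x.src := X.face_src 2 x
  refine NerveObj.ext_one ?_ ?_
  · change (X.face (0 : Fin 3) x).arr 0 - (X.face (1 : Fin 3) x).arr 0 +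
      (X.face (2 : Fin 3) x).arr 0 = 0
    rw [h0, h1, h2]
    abel
  · change (X.face (0 : Fin 3) x).src - (X.face (1 : Fin 3) x).src + (X.face (2 : Fin 3) x).src =
      X.ρ (x.arr 1) + x.src
    rw [k0, k1, k2, x.tail_two_one]
    abel

/-! ### Linear splittings and exactness of the augmented rows -/

/-- Linear sections of `ρ` and of the projection to the cokernel. -/
theorem exists_linear_sections : ∃ (σ : A →ₗ[k] R) (τ : X.Coker →ₗ[k] A),
    (∀ a, X.ρ (σ a) + τ (Coker.mk X a) = a) ∧ ∀ c, Coker.mk X (τ c) = c := by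
  obtain ⟨τ, hτ⟩ := (Coker.mk X).exists_rightInverse_of_surjective
    (LinearMap.range_eq_top.2 (Coker.mk_surjective X))
  obtain ⟨σ₀, hσ₀⟩ := (X.ρ : R →ₗ[k] A).rangeRestrict.exists_rightInverse_of_surjective
    (LinearMap.range_eq_top.2 (LinearMap.surjective_rangeRestrict _))
  have hτ' (c) : Coker.mk X (τ c) = c := LinearMap.congr_fun hτ c
  -- a - τ(ā) lies in ρ(R), where the section σ₀ of ρ is defined. So σ(a) can be taken to be σ₀(a -
  -- τ(ā)).
  have h (a : A) : (LinearMap.id - τ ∘ₗ Coker.mk X : A →ₗ[k] A) a ∈ LinearMap.range (X.ρ : R →ₗ[k] A) := by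
    refine (Submodule.Quotient.mk_eq_zero _).1 ?_
    change Coker.mk X (a - τ (Coker.mk X a)) = 0
    rw [map_sub, hτ', sub_self]
  refine ⟨σ₀ ∘ₗ (LinearMap.id - τ ∘ₗ Coker.mk X).codRestrict _ h, τ, fun a => ?_, hτ'⟩
  have := congrArg Subtype.val (LinearMap.congr_fun hσ₀
    ((LinearMap.id - τ ∘ₗ Coker.mk X).codRestrict _ h a))
  change X.ρ _ = a - τ (Coker.mk X a) at this
  rw [LinearMap.comp_apply, this, sub_add_cancel]

/-- The augmentation `A → Coker ρ` on `0`-simplices, as an algebra homomorphism. -/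
def augmentationHom : X.NerveObj 0 →ₙₐ[k] X.Coker := X.augmentation

/-- The tensor power of τ is a section. As τ need not be multiplicative, this is a map of tensor
powers of vector spaces only. -/
theorem chainsMap_augmentation_surjective (n : ℕ) :
    Function.Surjective (chainsMap X.augmentationHom n) := by
  obtain ⟨σ, τ, -, h⟩ := X.exists_linear_sections
  let s : X.Coker →ₗ[k] X.NerveObj 0 :=
    { toFun := fun c => X.zeroSimplex (τ c)
      map_add' := fun c c' => NerveObj.ext_zero (map_add τ c c')
      map_smul' := fun a c => NerveObj.ext_zero (map_smul τ a c) }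
  have hs : chainsMap X.augmentationHom n ∘ₗ PiTensorProduct.map (fun _ => s) = LinearMap.id := by
    refine PiTensorProduct.ext (MultilinearMap.ext fun g => ?_)
    rw [LinearMap.compMultilinearMap_apply, LinearMap.comp_apply, PiTensorProduct.map_tprod,
      chainsMap_tprod]
    exact congrArg _ (funext fun i => h (g i))
  exact fun x => ⟨_, LinearMap.congr_fun hs x⟩

/-- A linear contraction S : 𝔑₀ → 𝔑₁ with d₁S = id and d₀S factoring through Coker ρ keeps both
properties under tensor powers. On the kernel of the augmentation, d₀ - d₁ after the tensor power of
S is therefore -id. -/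
theorem exists_of_chainsMap_augmentation_eq_zero (n : ℕ)
    (x : HochschildChains k (X.NerveObj 0) n) (hx : chainsMap X.augmentationHom n x = 0) :
    ∃ y, chainsMap (X.face 0) n y - chainsMap (X.face 1) n y = x := by
  obtain ⟨σ, τ, h, -⟩ := X.exists_linear_sections
  -- S(a) = (σ(a), τ(ā)) is an arrow with source τ(ā) and target ρσ(a) + τ(ā) = a.
  let S : X.NerveObj 0 →ₗ[k] X.NerveObj 1 :=
    { toFun := fun x => (fun _ => σ x.src, τ (Coker.mk X x.src))
      map_add' := fun x y => NerveObj.ext_one (map_add σ x.src y.src)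
        (map_add (τ ∘ₗ Coker.mk X) x.src y.src)
      map_smul' := fun a x => NerveObj.ext_one (map_smul σ a x.src)
        (map_smul (τ ∘ₗ Coker.mk X) a x.src) }
  let s : X.Coker →ₗ[k] X.NerveObj 0 :=
    { toFun := fun c => X.zeroSimplex (τ c)
      map_add' := fun c c' => NerveObj.ext_zero (map_add τ c c')
      map_smul' := fun a c => NerveObj.ext_zero (map_smul τ a c) }
  have h0 : chainsMap (X.face 0) n ∘ₗ PiTensorProduct.map (fun _ => S) =
      PiTensorProduct.map (fun _ => s) ∘ₗ chainsMap X.augmentationHom n := by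
    refine PiTensorProduct.ext (MultilinearMap.ext fun g => ?_)
    simp only [LinearMap.compMultilinearMap_apply, LinearMap.comp_apply,
      PiTensorProduct.map_tprod, chainsMap_tprod]
    exact congrArg _ (funext fun i => NerveObj.ext_zero (X.face_zero_src_one _))
  have h1 : chainsMap (X.face 1) n ∘ₗ PiTensorProduct.map (fun _ => S) = LinearMap.id := by
    refine PiTensorProduct.ext (MultilinearMap.ext fun g => ?_)
    simp only [LinearMap.compMultilinearMap_apply, LinearMap.comp_apply,
      PiTensorProduct.map_tprod, chainsMap_tprod]
    exact congrArg _ (funext fun i => NerveObj.ext_zero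
      ((X.face_one_src_one _).trans (h (g i).src)))
  refine ⟨PiTensorProduct.map (fun _ => S) (-x), ?_⟩
  rw [← LinearMap.comp_apply, ← LinearMap.comp_apply, h0, h1, LinearMap.comp_apply, map_neg, hx,
    neg_zero, map_zero, LinearMap.id_apply, zero_sub, neg_neg]

/-! ### Commutators of arrows modulo [A, Ker ρ] -/

/-- The commutators of the chains on the arrows whose two images in `A ⊗ A` agree lie in
`[A, Ker ρ]`. -/
theorem exists_kerCommutator_eq_arr (v : HochschildChains k (X.NerveObj 1) 1)
    (hv : chainsMap (X.face 0) 1 v = chainsMap (X.face 1) 1 v) :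
    ∃ w ∈ X.kerCommutator, (w : R) = (commutatorMap k (X.NerveObj 1) v).arr 0 := by
  obtain ⟨σ, τ, h, -⟩ := X.exists_linear_sections
  have hσ (r : R) : X.ρ (σ (X.ρ r)) = X.ρ r := by
    have := h (X.ρ r)
    rwa [Coker.mk_ρ, map_zero, add_zero] at this
  let W : Submodule k R := X.kerCommutator.map X.ker.subtype
  -- `br r a` is the class of the bracket ra - ar modulo W = [A, Ker ρ].
  obtain ⟨br, br_apply⟩ : ∃ br : R →ₗ[k] A →ₗ[k] R ⧸ W,
      ∀ r a, br r a = W.mkQ (X.ract r a - X.lact a r) :=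
    ⟨(X.ract - X.lact.flip).compr₂ W.mkQ, fun _ _ => rfl⟩
  -- `br r a` depends only on ρ(r): here σρ(r) - r lies in Ker ρ, so its bracket with a lies in [A,
  -- Ker ρ].
  have h1 (r : R) (a : A) : br (σ (X.ρ r)) a = br r a := by
    rw [← sub_eq_zero, ← LinearMap.sub_apply, ← map_sub, br_apply]
    have hx : σ (X.ρ r) - r ∈ X.ker := by
      change X.ρ (σ (X.ρ r) - r) = 0
      rw [map_sub, hσ, sub_self]
    have hx' : X.lact a (σ (X.ρ r) - r) - X.ract (σ (X.ρ r) - r) a ∈ X.ker := by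
      change X.ρ (X.lact a (σ (X.ρ r) - r) - X.ract (σ (X.ρ r) - r) a) = 0
      have hx0 : X.ρ (σ (X.ρ r) - r) = 0 := hx
      rw [map_sub, X.ρ_lact, X.ρ_ract, hx0, mul_zero, zero_mul, sub_zero]
    rw [← neg_sub, map_neg, neg_eq_zero]
    refine (Submodule.Quotient.mk_eq_zero _).2 ⟨⟨_, hx'⟩, ?_, rfl⟩
    exact Submodule.subset_span ⟨a, ⟨_, hx⟩, rfl⟩
  -- The Peiffer identities make the bracket with ρ(s) the commutator in R, which is antisymmetric
  -- in r and s.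
  have h2 (r s : R) : br r (X.ρ s) = W.mkQ (r * s - s * r) := by
    rw [br_apply, X.peiffer_right, X.peiffer_left]
  -- T comes from the splitting a ⊗ c = ρσ(a) ⊗ c + τ(ā) ⊗ ρσ(c) + τ(ā) ⊗ τ(c̄), where τ(ā) = a -
  -- ρσ(a). The first summand contributes the bracket of σ(a) with c, the second minus the bracket
  -- of σ(c) with τ(ā), the third nothing.
  obtain ⟨T, hT⟩ : ∃ T : (⨂[k] (_ : Fin 2), A) →ₗ[k] R ⧸ W, ∀ g,
      T (PiTensorProduct.tprod k g) =
        br (σ (g 0)) (g 1) - br (σ (g 1)) (g 0 - X.ρ (σ (g 0))) :=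
    exists_lift_two (br ∘ₗ σ - (br ∘ₗ σ).flip ∘ₗ (LinearMap.id - (X.ρ : R →ₗ[k] A) ∘ₗ σ))
  let src₀ : X.NerveObj 0 →ₗ[k] A := LinearMap.snd k (Fin 0 → R) A
  let arr₀ : X.NerveObj 1 →ₗ[k] R := LinearMap.proj 0 ∘ₗ LinearMap.fst k (Fin 1 → R) A
  -- For (r, a) ⊗ (s, c), the R-component of the commutator is [r, s] + [r, c] - [s, a]. The
  -- difference of the values of T at (ρ(r) + a) ⊗ (ρ(s) + c) and a ⊗ c is the same modulo W: its
  -- remaining terms [σ(a), s] and [s, σ(a)] cancel.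
  have key : W.mkQ ∘ₗ arr₀ ∘ₗ commutatorMap k (X.NerveObj 1) =
      (T ∘ₗ PiTensorProduct.map (fun _ => src₀)) ∘ₗ
        (chainsMap (X.face 1) 1 - chainsMap (X.face 0) 1) := by
    refine linearMap_ext_chains_one k fun g => ?_
    simp only [LinearMap.comp_apply, LinearMap.sub_apply, chainsMap_tprod, map_sub,
      PiTensorProduct.map_tprod, hT, commutatorMap_tprod]
    have e0 (i) : src₀ (X.face 0 (g i)) = (g i).src := X.face_zero_src_one (g i)
    have e1 (i) : src₀ (X.face 1 (g i)) = X.ρ ((g i).arr 0) + (g i).src :=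
      X.face_one_src_one (g i)
    have e2 (i j) : arr₀ (g i * g j) = _ := NerveObj.mul_arr_one (g i) (g j)
    simp only [e0, e1, e2]
    generalize (g 0).src = a
    generalize (g 1).src = c
    generalize (g 0).arr 0 = r
    generalize (g 1).arr 0 = s
    simp only [LinearMap.add_apply, map_add, map_sub, h1, hσ, h2]
    simp only [br_apply, map_sub]
    abel
  have := LinearMap.congr_fun key v
  rw [LinearMap.comp_apply, LinearMap.comp_apply, LinearMap.comp_apply, LinearMap.sub_apply, hv,
    sub_self, map_zero] at this
  obtain ⟨w, hw, hw'⟩ := (Submodule.Quotient.mk_eq_zero W).1 this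
  exact ⟨w, hw, hw'⟩

theorem exists_commutatorMap_eq_oneSimplex (z : X.ker) (hz : z ∈ X.kerCommutator) :
    ∃ v : HochschildChains k (X.NerveObj 1) 1,
      chainsMap (X.face 0) 1 v - chainsMap (X.face 1) 1 v = 0 ∧
        commutatorMap k (X.NerveObj 1) v = X.oneSimplex z := by
  induction hz using Submodule.span_induction with
  | mem z hz =>
    obtain ⟨a, x, h⟩ := hz
    -- Both ends of the arrow (x, 0) are 0 since ρ(x) = 0, so both faces kill (0, a) ⊗ (x, 0). Its
    -- commutator is (ax - xa, 0).
    refine ⟨PiTensorProduct.tprod k ![X.identityArrow a, X.oneSimplex x], ?_, ?_⟩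
    · have hx : X.ρ (x : R) = 0 := x.2
      have h0 : X.face 0 (X.oneSimplex x) = 0 := NerveObj.ext_zero (X.face_zero_src_one _)
      have h1 : X.face 1 (X.oneSimplex x) = 0 := NerveObj.ext_zero
        ((X.face_one_src_one _).trans ((add_zero _).trans hx))
      rw [chainsMap_tprod, chainsMap_tprod, MultilinearMap.map_coord_zero _ 1 h0,
        MultilinearMap.map_coord_zero _ 1 h1, sub_zero]
    · rw [commutatorMap_tprod]
      change X.identityArrow a * X.oneSimplex x -
        X.oneSimplex x * X.identityArrow a = _
      refine NerveObj.ext_one ?_ ?_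
      · refine (congrArg₂ (· - ·) (NerveObj.mul_arr_one (X.identityArrow a)
          (X.oneSimplex x)) (NerveObj.mul_arr_one (X.oneSimplex x)
          (X.identityArrow a))).trans ?_
        change (0 * (x : R) + X.lact a x + X.ract 0 0) - (x * 0 + X.lact 0 0 + X.ract x a) = z
        rw [h]
        simp
      · change a * 0 - 0 * a = 0
        simp
  | zero => exact ⟨0, by simp, by rw [map_zero]; rfl⟩
  | add x y _ _ hx hy =>
    obtain ⟨v, hv, hv'⟩ := hx
    obtain ⟨v', hw, hw'⟩ := hy
    refine ⟨v + v', ?_, ?_⟩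
    · rw [map_add, map_add, add_sub_add_comm, hv, hw, add_zero]
    · rw [map_add, hv', hw']
      exact NerveObj.ext_one rfl (add_zero _)
  | smul c x _ hx =>
    obtain ⟨v, hv, hv'⟩ := hx
    refine ⟨c • v, ?_, ?_⟩
    · rw [map_smul, map_smul, ← smul_sub, hv, smul_zero]
    · rw [map_smul, hv']
      exact NerveObj.ext_one rfl (smul_zero _)

/-- `[Coker ρ, Coker ρ]` is the image of the commutators of `A`. -/
theorem range_mk_commutatorMap :
    LinearMap.range (Coker.mk X ∘ₗ LinearMap.snd k (Fin 0 → R) A ∘ₗ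
      (commutatorMap k (X.NerveObj 0) : _ →ₗ[k] (Fin 0 → R) × A)) =
      commutatorSubspace k X.Coker := by
  apply le_antisymm
  · rw [← Submodule.ker_mkQ (commutatorSubspace k X.Coker), LinearMap.range_le_ker_iff]
    refine linearMap_ext_chains_one k fun g => ?_
    refine (Submodule.Quotient.mk_eq_zero _).2 (Submodule.subset_span
      ⟨Coker.mk X (g 0).src, Coker.mk X (g 1).src, ?_⟩)
    refine (congrArg (fun z : X.NerveObj 0 => Coker.mk X z.src) (commutatorMap_tprod k g)).trans ?_
    exact map_sub (Coker.mk X) ((g 0).src * (g 1).src) ((g 1).src * (g 0).src)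
  · refine Submodule.span_le.2 ?_
    rintro _ ⟨a, b, rfl⟩
    obtain ⟨a, rfl⟩ := Coker.mk_surjective X a
    obtain ⟨b, rfl⟩ := Coker.mk_surjective X b
    refine ⟨PiTensorProduct.tprod k ![X.zeroSimplex a, X.zeroSimplex b], ?_⟩
    refine (congrArg (fun z : X.NerveObj 0 => Coker.mk X z.src)
      (commutatorMap_tprod k ![X.zeroSimplex a, X.zeroSimplex b])).trans ?_
    exact map_sub (Coker.mk X) (a * b) (b * a)

end AlgCrossedModule

/-! ### The bicomplex of the nerve for a functor Φ with exact augmented rows -/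

namespace AlgCrossedModule

variable {k : Type u} [Field k] {R A : Type v}
  [NonUnitalRing R] [Module k R] [IsScalarTower k R R] [SMulCommClass k R R]
  [NonUnitalRing A] [Module k A] [IsScalarTower k A A] [SMulCommClass k A A]
  (X : AlgCrossedModule k R A)
  (Φ : NonUnitalAlgCat.{u, v} k ⥤ ChainComplex (ModuleCat.{max u v} k) ℕ)

/-- The map induced by a face of the nerve on `Φ`. -/
def faceMap {n : ℕ} (i : Fin (n + 2)) : Φ.obj ⟨X.NerveObj (n + 1)⟩ ⟶ Φ.obj ⟨X.NerveObj n⟩ :=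
  Φ.map (X := ⟨X.NerveObj (n + 1)⟩) (Y := ⟨X.NerveObj n⟩) (X.face i)

/-- The map induced by the augmentation of the nerve on `Φ`. -/
def augmentationMap : Φ.obj ⟨X.NerveObj 0⟩ ⟶ Φ.obj ⟨X.Coker⟩ :=
  Φ.map (X := ⟨X.NerveObj 0⟩) (Y := ⟨X.Coker⟩) X.augmentationHom

/-- The horizontal differential `Φₙ(𝔑₁) → Φₙ(𝔑₀)`. -/
def rowD₁ (n : ℕ) : (Φ.obj ⟨X.NerveObj 1⟩).X n →ₗ[k] (Φ.obj ⟨X.NerveObj 0⟩).X n :=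
  ((X.faceMap Φ 0).f n).hom - ((X.faceMap Φ 1).f n).hom

/-- The horizontal differential `Φₙ(𝔑₂) → Φₙ(𝔑₁)`. -/
def rowD₂ (n : ℕ) : (Φ.obj ⟨X.NerveObj 2⟩).X n →ₗ[k] (Φ.obj ⟨X.NerveObj 1⟩).X n :=
  ((X.faceMap Φ 0).f n).hom - ((X.faceMap Φ 1).f n).hom + ((X.faceMap Φ 2).f n).hom

/-- The augmented rows `Φₙ(𝔑₁) → Φₙ(𝔑₀) → Φₙ(Coker ρ) → 0` are exact. -/
structure RowExact : Prop where
  surjective : ∀ n, Function.Surjective ((X.augmentationMap Φ).f n).hom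
  exact : ∀ n x, ((X.augmentationMap Φ).f n).hom x = 0 → ∃ y, X.rowD₁ Φ n y = x

theorem simplicialBicomplex_d_one_zero (n : ℕ) :
    (((simplicialBicomplex Φ X.nerve).d 1 0).f n).hom = X.rowD₁ Φ n := by
  have hd : (simplicialBicomplex Φ X.nerve).d 1 0 =
      Φ.map (X.nerve.δ (0 : Fin 2)) - Φ.map (X.nerve.δ (1 : Fin 2)) := by
    refine (AlgebraicTopology.alternatingFaceMapComplex_obj_d _ 0).trans ?_
    rw [AlgebraicTopology.AlternatingFaceMapComplex.objD, Fin.sum_univ_two, Fin.val_zero,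
      Fin.val_one, pow_zero, pow_one, one_smul, neg_smul, one_smul, ← sub_eq_add_neg]
    rfl
  rw [hd]
  rfl

theorem simplicialBicomplex_d_two_one (n : ℕ) :
    (((simplicialBicomplex Φ X.nerve).d 2 1).f n).hom = X.rowD₂ Φ n := by
  have hd : (simplicialBicomplex Φ X.nerve).d 2 1 =
      Φ.map (X.nerve.δ (0 : Fin 3)) - Φ.map (X.nerve.δ (1 : Fin 3)) +
        Φ.map (X.nerve.δ (2 : Fin 3)) := by
    refine (AlgebraicTopology.alternatingFaceMapComplex_obj_d _ 1).trans ?_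
    rw [AlgebraicTopology.AlternatingFaceMapComplex.objD, Fin.sum_univ_three, Fin.val_zero,
      Fin.val_one, Fin.val_two, pow_zero, pow_one, one_smul, neg_smul, one_smul,
      ← sub_eq_add_neg, neg_one_sq, one_smul]
    rfl
  rw [hd]
  rfl

/-- `r ↦ (r, 0)` as a linear map. -/
def oneSimplexₗ : R →ₗ[k] X.NerveObj 1 where
  toFun := X.oneSimplex
  map_add' _ _ := NerveObj.ext_one rfl (add_zero _).symm
  map_smul' _ _ := NerveObj.ext_one rfl (smul_zero _).symm

/-- `a ↦ a` as a linear map from `A` to the `0`-simplices of the nerve. -/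
def zeroSimplexₗ : A →ₗ[k] X.NerveObj 0 where
  toFun := X.zeroSimplex
  map_add' _ _ := NerveObj.ext_zero rfl
  map_smul' _ _ := NerveObj.ext_zero rfl

variable {Φ} (D : LowDegreeChains Φ)

theorem faceMap_incl₀ {n : ℕ} (i : Fin (n + 2)) (x : X.NerveObj (n + 1)) :
    ((X.faceMap Φ i).f 0).hom (D.incl₀ ⟨X.NerveObj (n + 1)⟩ x) =
      D.incl₀ ⟨X.NerveObj n⟩ (X.face i x) :=
  D.map_incl₀ (B := ⟨X.NerveObj (n + 1)⟩) (B' := ⟨X.NerveObj n⟩) (X.face i) x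

theorem rowD₁_incl₀ (x : X.NerveObj 1) :
    X.rowD₁ Φ 0 (D.incl₀ ⟨X.NerveObj 1⟩ x) =
      D.incl₀ ⟨X.NerveObj 0⟩ (X.zeroSimplex (- X.ρ (x.arr 0))) := by
  rw [rowD₁, LinearMap.sub_apply, faceMap_incl₀, faceMap_incl₀, ← map_sub]
  refine congrArg _ (NerveObj.ext_zero ?_)
  refine (congrArg₂ (· - ·) (X.face_zero_src_one x) (X.face_one_src_one x)).trans ?_
  change x.src - (X.ρ (x.arr 0) + x.src) = - X.ρ (x.arr 0)
  abel

theorem rowD₂_incl₀ (x : X.NerveObj 2) :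
    X.rowD₂ Φ 0 (D.incl₀ ⟨X.NerveObj 2⟩ x) =
      D.incl₀ ⟨X.NerveObj 1⟩ (X.identityArrow (X.ρ (x.arr 1) + x.src)) := by
  rw [rowD₂, LinearMap.add_apply, LinearMap.sub_apply, faceMap_incl₀, faceMap_incl₀,
    faceMap_incl₀, ← map_sub, ← map_add]
  exact congrArg _ (X.face_two_alternating x)

theorem rowD₁_incl₁ (v : HochschildChains k (X.NerveObj 1) 1) :
    X.rowD₁ Φ 1 (D.incl₁ ⟨X.NerveObj 1⟩ v) = D.incl₁ ⟨X.NerveObj 0⟩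
      (chainsMap (X.face 0) 1 v - chainsMap (X.face 1) 1 v) := by
  rw [map_sub]
  exact congrArg₂ (· - ·)
    (D.map_incl₁ (B := ⟨X.NerveObj 1⟩) (B' := ⟨X.NerveObj 0⟩) (X.face 0) v)
    (D.map_incl₁ (B := ⟨X.NerveObj 1⟩) (B' := ⟨X.NerveObj 0⟩) (X.face 1) v)

theorem proj₁_rowD₁ (y : (Φ.obj ⟨X.NerveObj 1⟩).X 1) :
    D.proj₁ ⟨X.NerveObj 0⟩ (X.rowD₁ Φ 1 y) =
      chainsMap (X.face 0) 1 (D.proj₁ ⟨X.NerveObj 1⟩ y) -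
        chainsMap (X.face 1) 1 (D.proj₁ ⟨X.NerveObj 1⟩ y) := by
  rw [rowD₁, LinearMap.sub_apply, map_sub]
  exact congrArg₂ (· - ·)
    (D.proj₁_map (B := ⟨X.NerveObj 1⟩) (B' := ⟨X.NerveObj 0⟩) (X.face 0) y)
    (D.proj₁_map (B := ⟨X.NerveObj 1⟩) (B' := ⟨X.NerveObj 0⟩) (X.face 1) y)

/-- The bottom row has horizontal homology Ker ρ at 𝔑₁: a cycle (r, a) has ρ(r) = 0 and equals (r,
0) + (0, a), where (0, a) is the image of the degenerate simplex (0, 0, a). -/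
theorem exists_of_rowD₁_incl₀_eq_zero (x : (Φ.obj ⟨X.NerveObj 1⟩).X 0)
    (hx : X.rowD₁ Φ 0 x = 0) : ∃ (z : X.ker) (y : (Φ.obj ⟨X.NerveObj 2⟩).X 0),
      x = D.incl₀ ⟨X.NerveObj 1⟩ (X.oneSimplex z) + X.rowD₂ Φ 0 y := by
  obtain ⟨(x : X.NerveObj 1), rfl⟩ := (D.bijective_incl₀ ⟨X.NerveObj 1⟩).2 x
  have hx' := (D.bijective_incl₀ ⟨X.NerveObj 0⟩).1
    (((X.rowD₁_incl₀ D x).symm.trans hx).trans (map_zero _).symm)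
  have hρ : - X.ρ (x.arr 0) = 0 := congrArg NerveObj.src hx'
  rw [neg_eq_zero] at hρ
  let y : X.NerveObj 2 := (fun _ => 0, x.src)
  refine ⟨⟨x.arr 0, hρ⟩, D.incl₀ ⟨X.NerveObj 2⟩ y, ?_⟩
  rw [rowD₂_incl₀, ← map_add]
  refine congrArg _ (NerveObj.ext_one (add_zero _).symm ?_)
  change x.src = 0 + (X.ρ 0 + x.src)
  rw [map_zero, zero_add, zero_add]

/-- These are the relations among the classes of (z, 0) in the kernel of Tot → Y: horizontal
boundaries from 𝔑₂, together with vertical boundaries of the y whose two faces agree. -/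
theorem mem_kerCommutator_iff (z : X.ker) : z ∈ X.kerCommutator ↔
    ∃ (x : (Φ.obj ⟨X.NerveObj 2⟩).X 0) (y : (Φ.obj ⟨X.NerveObj 1⟩).X 1),
      X.rowD₁ Φ 1 y = 0 ∧ X.rowD₂ Φ 0 x - ((Φ.obj ⟨X.NerveObj 1⟩).d 1 0).hom y =
        D.incl₀ ⟨X.NerveObj 1⟩ (X.oneSimplex z) := by
  constructor
  · intro hz
    obtain ⟨v, hv, hv'⟩ := X.exists_commutatorMap_eq_oneSimplex z hz
    -- The sign compensates that of the vertical differential of column 1.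
    refine ⟨0, - D.incl₁ ⟨X.NerveObj 1⟩ v, ?_, ?_⟩
    · rw [map_neg, rowD₁_incl₁, hv, map_zero, neg_zero]
    · rw [map_neg, D.d_incl₁, hv', map_zero, sub_neg_eq_add, zero_add]
  · rintro ⟨x, y, hy, hxy⟩
    obtain ⟨(x : X.NerveObj 2), rfl⟩ := (D.bijective_incl₀ ⟨X.NerveObj 2⟩).2 x
    obtain ⟨w, hw, hw'⟩ := X.exists_kerCommutator_eq_arr (D.proj₁ ⟨X.NerveObj 1⟩ y)
      (sub_eq_zero.1 ((X.proj₁_rowD₁ D y).symm.trans ((congrArg _ hy).trans (map_zero _))))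
    rw [rowD₂_incl₀, D.d_eq, ← map_sub] at hxy
    -- The boundary of a 2-simplex is an identity arrow and drops out of the R-component, which
    -- leaves minus the commutator.
    have h := congrArg (fun s : X.NerveObj 1 => s.arr 0)
      ((D.bijective_incl₀ ⟨X.NerveObj 1⟩).1 hxy)
    change 0 - (commutatorMap k (X.NerveObj 1) (D.proj₁ ⟨X.NerveObj 1⟩ y)).arr 0 = (z : R) at h
    rw [← hw', zero_sub] at h
    have : z = -w := Subtype.ext h.symm
    rw [this]
    exact neg_mem hw

/-- Commutators of Coker ρ lift to commutators of A up to ρ(R). In the spot (0, 0), ρ(R) is the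
horizontal image and the commutators of A form the vertical one. -/
theorem mk_mem_commutatorSubspace_iff (a : A) :
    Coker.mk X a ∈ commutatorSubspace k X.Coker ↔
      ∃ (x : (Φ.obj ⟨X.NerveObj 1⟩).X 0) (y : (Φ.obj ⟨X.NerveObj 0⟩).X 1),
        X.rowD₁ Φ 0 x + ((Φ.obj ⟨X.NerveObj 0⟩).d 1 0).hom y =
          D.incl₀ ⟨X.NerveObj 0⟩ (X.zeroSimplex a) := by
  rw [← range_mk_commutatorMap]
  constructor
  · rintro ⟨v, hv⟩
    obtain ⟨r, hr⟩ := (Submodule.Quotient.eq _).1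
      (hv : Coker.mk X (commutatorMap k (X.NerveObj 0) v).src = Coker.mk X a)
    change X.ρ r = (commutatorMap k (X.NerveObj 0) v).src - a at hr
    refine ⟨D.incl₀ ⟨X.NerveObj 1⟩ (X.oneSimplex r), D.incl₁ ⟨X.NerveObj 0⟩ v, ?_⟩
    rw [rowD₁_incl₀, D.d_incl₁, ← map_add]
    refine congrArg _ (NerveObj.ext_zero ?_)
    change - X.ρ r + (commutatorMap k (X.NerveObj 0) v).src = a
    rw [hr]
    abel
  · rintro ⟨x, y, h⟩
    obtain ⟨(x : X.NerveObj 1), rfl⟩ := (D.bijective_incl₀ ⟨X.NerveObj 1⟩).2 x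
    rw [rowD₁_incl₀, D.d_eq, ← map_add] at h
    have h2 : - X.ρ (x.arr 0) +
        (commutatorMap k (X.NerveObj 0) (D.proj₁ ⟨X.NerveObj 0⟩ y)).src = a :=
      congrArg (fun s : X.NerveObj 0 => s.src) ((D.bijective_incl₀ ⟨X.NerveObj 0⟩).1 h)
    refine ⟨D.proj₁ ⟨X.NerveObj 0⟩ y, ?_⟩
    rw [← h2, map_add, map_neg, Coker.mk_ρ, neg_zero, zero_add]
    rfl

/-- The bicomplex criterion applies with Z = Ker ρ, embedded in 𝔑₁ by z ↦ (z, 0), and W = [A, Ker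
ρ]. -/
theorem exists_exact_sequence_toCoker (hΦ : X.RowExact Φ) :
    ∃ (δ : (Φ.obj ⟨X.Coker⟩).homology 2 →ₗ[k] X.ker ⧸ X.kerCommutator)
      (β : (X.ker ⧸ X.kerCommutator) →ₗ[k] (X.complex Φ).homology 1),
      (∀ x : X.ker, IsHomologyClass (X.complex Φ) 1
        (X.rowZeroChain Φ 1 (D.incl₀ ⟨X.NerveObj 1⟩ (X.oneSimplex x)))
        (β (Submodule.Quotient.mk x))) ∧
      Function.Exact (HomologicalComplex.homologyMap (X.toCoker Φ) 2).hom δ ∧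
      Function.Exact δ β ∧
      Function.Exact β (HomologicalComplex.homologyMap (X.toCoker Φ) 1).hom ∧
      Function.Surjective (HomologicalComplex.homologyMap (X.toCoker Φ) 1).hom := by
  refine exists_exact_sequence_totalAugmentation (simplicialBicomplex Φ X.nerve)
    (Φ.obj ⟨X.Coker⟩) (Φ.map X.augmentation) (X.simplicialBicomplex_d_comp_augmentation Φ)
    hΦ.surjective ?_ (D.incl₀ ⟨X.NerveObj 1⟩ ∘ₗ X.oneSimplexₗ ∘ₗ X.ker.subtype) ?_ ?_
    X.kerCommutator ?_
  · intro n
    rw [simplicialBicomplex_d_one_zero]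
    exact hΦ.exact n
  · intro z
    rw [simplicialBicomplex_d_one_zero]
    refine (X.rowD₁_incl₀ D (X.oneSimplex z)).trans ?_
    have hz : X.ρ (z : R) = 0 := z.2
    change D.incl₀ ⟨X.NerveObj 0⟩ (X.zeroSimplexₗ (-X.ρ (z : R))) = 0
    rw [hz, neg_zero, map_zero, map_zero]
  · rw [simplicialBicomplex_d_one_zero, simplicialBicomplex_d_two_one]
    exact X.exists_of_rowD₁_incl₀_eq_zero D
  · rw [simplicialBicomplex_d_one_zero, simplicialBicomplex_d_two_one]
    exact X.mem_kerCommutator_iff D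

theorem exists_homology_zero_equiv_coker :
    ∃ e : (X.complex Φ).homology 0 ≃ₗ[k] X.Coker ⧸ commutatorSubspace k X.Coker,
      ∀ a : A, IsHomologyClass (X.complex Φ) 0
        (X.rowZeroChain Φ 0 (D.incl₀ ⟨X.NerveObj 0⟩ (X.zeroSimplex a)))
        (e.symm (Submodule.Quotient.mk (Coker.mk X a))) := by
  refine exists_homology_zero_equiv (X.complex Φ)
    (totalIncl (simplicialBicomplex Φ X.nerve) 0 0 0 rfl ∘ₗ
      D.incl₀ ⟨X.NerveObj 0⟩ ∘ₗ X.zeroSimplexₗ) (fun t => ?_)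
    ((commutatorSubspace k X.Coker).mkQ ∘ₗ Coker.mk X)
    ((Submodule.mkQ_surjective _).comp (Coker.mk_surjective X)) (fun a => ?_)
  · obtain ⟨y, rfl⟩ := exists_totalIncl_zero (simplicialBicomplex Φ X.nerve) t
    obtain ⟨(x : X.NerveObj 0), rfl⟩ := (D.bijective_incl₀ ⟨X.NerveObj 0⟩).2 y
    have hx : X.zeroSimplexₗ x.src = x := NerveObj.ext_zero rfl
    exact ⟨x.src, congrArg (fun s => totalIncl (simplicialBicomplex Φ X.nerve) 0 0 0 rfl
      (D.incl₀ ⟨X.NerveObj 0⟩ s)) hx⟩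
  · refine (exists_total_d_one_zero_iff (simplicialBicomplex Φ X.nerve) _).trans ?_
    rw [LinearMap.comp_apply, Submodule.mkQ_apply, Submodule.Quotient.mk_eq_zero,
      simplicialBicomplex_d_one_zero]
    exact (X.mk_mem_commutatorSubspace_iff D a).symm

/-! ### Exactness of the augmented rows for the two functors -/

/-- Exactness of rows ignores the differentials. The Hochschild and bar complexes share their chain
spaces and induced maps, so the same contraction serves for both. -/
theorem rowExact_hochschildComplex : X.RowExact (hochschildComplex k) where
  surjective := X.chainsMap_augmentation_surjective
  exact := X.exists_of_chainsMap_augmentation_eq_zero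

theorem rowExact_barComplex : X.RowExact (barComplex k) where
  surjective := X.chainsMap_augmentation_surjective
  exact := X.exists_of_chainsMap_augmentation_eq_zero

theorem rowExact_cyclicColumn : (p : ℕ) → X.RowExact (cyclicColumn k p)
  | 0 => X.rowExact_hochschildComplex
  | 1 => X.rowExact_barComplex
  | p + 2 => rowExact_cyclicColumn p

theorem rowExact_cyclicColumn₂ : (p : ℕ) → X.RowExact (cyclicColumn₂ k p)
  | 0 => X.rowExact_hochschildComplex
  | 1 => X.rowExact_barComplex
  | _ + 2 => by
    have h (n : ℕ) : Subsingleton ((0 : ChainComplex (ModuleCat.{max u v} k) ℕ).X n) :=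
      ModuleCat.subsingleton_of_isZero
        ((HomologicalComplex.eval _ _ n).map_isZero (Limits.isZero_zero _))
    exact ⟨fun n x => ⟨0, (h n).elim _ _⟩, fun n x _ => ⟨0, (h n).elim _ _⟩⟩

/-- If the columns of a functorial bicomplex have exact augmented rows, then so has its total
complex. -/
theorem RowExact.total (C : NonUnitalAlgCat.{u, v} k ⥤
      HomologicalComplex₂ (ModuleCat.{max u v} k) (ComplexShape.down ℕ) (ComplexShape.down ℕ))
    (h : ∀ p, X.RowExact (C ⋙ HomologicalComplex.eval _ _ p)) :
    X.RowExact (C ⋙ HomologicalComplex₂.totalFunctor _ _ _ (ComplexShape.down ℕ)) where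
  surjective n y := by
    -- Degree n of the total complex is the finite sum of the spots (p, n - p), and induced maps act
    -- on each spot separately. So preimages can be chosen spot by spot, with no compatibility with
    -- differentials to check.
    choose x hx using fun p : Fin (n + 1) =>
      (h p).surjective (n - p) (totalProj _ p (n - p) n (by omega) y)
    refine ⟨∑ p : Fin (n + 1), totalIncl (C.obj ⟨X.NerveObj 0⟩) p (n - p) n (by omega) (x p), ?_⟩
    refine (map_sum _ _ _).trans ?_
    refine Eq.trans (Finset.sum_congr rfl fun p _ => ?_)
      (sum_totalIncl_totalProj (C.obj ⟨X.Coker⟩) n y)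
    exact (total_map_totalIncl _ _ _ _ _ _).trans (congrArg _ (hx p))
  exact n x hx := by
    have hx' (p : Fin (n + 1)) := (h p).exact (n - p)
      (totalProj (C.obj ⟨X.NerveObj 0⟩) p (n - p) n (by omega) x)
      ((totalProj_total_map _ _ _ _ _ x).symm.trans ((congrArg _ hx).trans (map_zero _)))
    choose y hy using hx'
    refine ⟨∑ p : Fin (n + 1), totalIncl (C.obj ⟨X.NerveObj 1⟩) p (n - p) n (by omega) (y p), ?_⟩
    refine (map_sum _ _ _).trans ?_
    refine Eq.trans (Finset.sum_congr rfl fun p _ => ?_)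
      (sum_totalIncl_totalProj (C.obj ⟨X.NerveObj 0⟩) n x)
    refine (congrArg₂ (· - ·)
      (total_map_totalIncl (C.map (X := ⟨X.NerveObj 1⟩) (Y := ⟨X.NerveObj 0⟩) (X.face 0))
        p (n - p) n (by omega) (y p))
      (total_map_totalIncl (C.map (X := ⟨X.NerveObj 1⟩) (Y := ⟨X.NerveObj 0⟩) (X.face 1))
        p (n - p) n (by omega) (y p))).trans ?_
    exact (map_sub _ _ _).symm.trans (congrArg _ (hy p))

theorem rowExact_cyclicComplex : X.RowExact (cyclicComplex k) :=
  RowExact.total X (cyclicBicomplex k) X.rowExact_cyclicColumn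

theorem rowExact_cyclicComplex₂ : X.RowExact (cyclicComplex₂ k) :=
  RowExact.total X (cyclicBicomplex₂ k) X.rowExact_cyclicColumn₂

end AlgCrossedModule

/-! ### Degrees 0 and 1 of the two total complexes -/

section LowDegreeInstances

variable (k : Type u) [Field k]

/-- On a single tensor factor t is the identity with sign (-1)⁰. Hence column 1 adds nothing to the
differential from degree 1 to degree 0. -/
theorem oneSubCyclic_app_zero (B : NonUnitalAlgCat.{u, v} k) :
    ((oneSubCyclic k).app B).f 0 = 0 := by
  ext x
  have : rotate k B.carrier 0 = LinearMap.id :=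
    PiTensorProduct.ext (MultilinearMap.ext fun g => by
      rw [LinearMap.compMultilinearMap_apply, rotate_tprod]
      exact congrArg _ (funext fun i => congrArg g (Subsingleton.elim (α := Fin 1) _ _)))
  change (LinearMap.id - (-1 : k) ^ 0 • rotate k B.carrier 0 :
    HochschildChains k B.carrier 0 →ₗ[k] HochschildChains k B.carrier 0) x = 0
  rw [pow_zero, this, one_smul, sub_self]
  rfl

theorem cyclicBicomplex_d_one_zero (B : NonUnitalAlgCat.{u, v} k) :
    (((cyclicBicomplex k).obj B).d 1 0).f 0 = 0 := by
  have h : (ChainComplex.of (cyclicColumn.{u, v} k) (cyclicRowD k) (cyclicRowD_comp k)).d 1 0 =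
      cyclicRowD k 0 := ChainComplex.of_d _ _ 0
  exact (congrArg (fun φ : cyclicColumn.{u, v} k 1 ⟶ cyclicColumn k 0 => (φ.app B).f 0) h).trans
    (oneSubCyclic_app_zero k B)

theorem cyclicBicomplex₂_d_one_zero (B : NonUnitalAlgCat.{u, v} k) :
    (((cyclicBicomplex₂ k).obj B).d 1 0).f 0 = 0 := by
  have h : (ChainComplex.of (cyclicColumn₂.{u, v} k) (cyclicRowD₂ k) (cyclicRowD₂_comp k)).d 1 0 =
      cyclicRowD₂ k 0 := ChainComplex.of_d _ _ 0
  exact (congrArg (fun φ : cyclicColumn₂.{u, v} k 1 ⟶ cyclicColumn₂ k 0 => (φ.app B).f 0) h).trans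
    (oneSubCyclic_app_zero k B)

theorem hochschildComplex_d_one_zero (B : NonUnitalAlgCat.{u, v} k)
    (x : HochschildChains k B.carrier 1) :
    (((hochschildComplex k).obj B).d 1 0).hom x = hochschildD k B.carrier 0 x := by
  have h : ((hochschildComplex k).obj B).d 1 0 = ModuleCat.ofHom (hochschildD k B.carrier 0) :=
    ChainComplex.of_d (fun n => ModuleCat.of k (HochschildChains k B.carrier n))
      (fun n => ModuleCat.ofHom (hochschildD k B.carrier n)) 0
  exact LinearMap.congr_fun (congrArg ModuleCat.Hom.hom h) x

/-- `B` as the space of Hochschild `0`-chains. -/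
def zeroChains (B : Type v) [NonUnitalRing B] [Module k B] : B ≃ₗ[k] HochschildChains k B 0 :=
  (PiTensorProduct.subsingletonEquiv (R := k) (s := fun _ => B) (0 : Fin 1)).symm

theorem zeroChains_apply {B : Type v} [NonUnitalRing B] [Module k B] (b : B) :
    zeroChains k B b = PiTensorProduct.tprod k (fun _ => b) :=
  PiTensorProduct.subsingletonEquiv_symm_apply' (0 : Fin 1) b

variable {k}

/-- The low degrees of the total complex of a bicomplex whose column of index `0` begins like the
Hochschild complex, and whose horizontal differential vanishes at the `(1, 0)` spot. -/
def LowDegreeChains.total (C : NonUnitalAlgCat.{u, v} k ⥤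
      HomologicalComplex₂ (ModuleCat.{max u v} k) (ComplexShape.down ℕ) (ComplexShape.down ℕ))
    (j : ∀ (B : NonUnitalAlgCat.{u, v} k) (q : ℕ),
      HochschildChains k B.carrier q ≃ₗ[k] ((C.obj B).X 0).X q)
    (hj : ∀ {B B' : NonUnitalAlgCat.{u, v} k} (f : B.carrier →ₙₐ[k] B'.carrier) (q : ℕ) x,
      (((C.map (Y := B') f).f 0).f q).hom (j B q x) = j B' q (chainsMap f q x))
    (hd : ∀ B x, (((C.obj B).X 0).d 1 0).hom (j B 1 x) = j B 0 (hochschildD k B.carrier 0 x))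
    (h : ∀ B, ((C.obj B).d 1 0).f 0 = 0) :
    LowDegreeChains (C ⋙ HomologicalComplex₂.totalFunctor _ _ _ (ComplexShape.down ℕ)) where
  incl₀ B := totalIncl (C.obj B) 0 0 0 rfl ∘ₗ (j B 0).toLinearMap ∘ₗ
    (zeroChains k B.carrier).toLinearMap
  bijective_incl₀ B := by
    refine ⟨(totalIncl_injective _ 0 0 0 rfl).comp
      ((j B 0).injective.comp (zeroChains k B.carrier).injective), fun t => ?_⟩
    obtain ⟨y, rfl⟩ := exists_totalIncl_zero (C.obj B) t
    obtain ⟨y, rfl⟩ := (j B 0).surjective y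
    obtain ⟨y, rfl⟩ := (zeroChains k B.carrier).surjective y
    exact ⟨y, rfl⟩
  map_incl₀ {B B'} f x := by
    refine (total_map_totalIncl (C.map (Y := B') f) 0 0 0 rfl _).trans (congrArg _ ?_)
    refine (hj f 0 _).trans (congrArg _ ?_)
    rw [LinearEquiv.coe_coe, LinearEquiv.coe_coe, zeroChains_apply, zeroChains_apply,
      chainsMap_tprod]
  incl₁ B := totalIncl (C.obj B) 0 1 1 rfl ∘ₗ (j B 1).toLinearMap
  map_incl₁ {B B'} f x :=
    (total_map_totalIncl (C.map (Y := B') f) 0 1 1 rfl _).trans (congrArg _ (hj f 1 x))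
  d_incl₁ B x := by
    refine (total_d_totalIncl_zero (C.obj B) 0 _).trans (congrArg _ ((hd B x).trans ?_))
    refine congrArg (j B 0) ?_
    rw [LinearEquiv.coe_coe, zeroChains_apply, tprod_commutatorMap]
  proj₁ B := (j B 1).symm.toLinearMap ∘ₗ totalProj (C.obj B) 0 1 1 rfl
  proj₁_map {B B'} f x := by
    have h1 := totalProj_total_map (C.map (Y := B') f) 0 1 1 rfl x
    obtain ⟨y, hy⟩ := (j B 1).surjective (totalProj (C.obj B) 0 1 1 rfl x)
    refine (congrArg (j B' 1).symm (h1.trans ((congrArg _ hy.symm).trans (hj f 1 y)))).trans ?_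
    exact ((j B' 1).symm_apply_apply _).trans (congrArg (chainsMap f 1)
      (((j B 1).symm_apply_apply y).symm.trans (congrArg (j B 1).symm hy)))
  d_eq B x := by
    obtain ⟨y, z, rfl⟩ := exists_totalIncl_one (C.obj B) x
    obtain ⟨y, rfl⟩ := (j B 1).surjective y
    have hp : (j B 1).symm (totalProj (C.obj B) 0 1 1 rfl
        (totalIncl (C.obj B) 0 1 1 rfl (j B 1 y) + totalIncl (C.obj B) 1 0 1 rfl z)) = y := by
      rw [map_add (totalProj (C.obj B) 0 1 1 rfl), totalProj_totalIncl,
        totalProj_totalIncl_of_ne _ _ _ _ _ _ _ _ (by simp), add_zero,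
        LinearEquiv.symm_apply_apply]
    refine Eq.trans ?_ (congrArg (fun t => totalIncl (C.obj B) 0 0 0 rfl
      (j B 0 (zeroChains k B.carrier (commutatorMap k B.carrier t)))) hp.symm)
    refine (map_add _ _ _).trans ?_
    -- The summand z at the spot (1, 0) has boundary zero by `h`, so only the Hochschild boundary of
    -- y remains.
    have h1 := total_d_totalIncl_succ_zero (C.obj B) 0 z
    have h2 := (total_d_totalIncl_zero (C.obj B) 0 (j B 1 y)).trans (congrArg _ (hd B y))
    rw [h B] at h1
    refine (congrArg₂ (· + ·) h2 (h1.trans (map_zero _))).trans ((add_zero _).trans ?_)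
    refine congrArg _ (congrArg (j B 0) ?_)
    rw [zeroChains_apply, tprod_commutatorMap]

variable (k)

/-- The low degrees of the complex `CC(B)`. -/
def cyclicLowDegreeChains : LowDegreeChains (cyclicComplex.{u, v} k) :=
  LowDegreeChains.total (cyclicBicomplex k)
    (fun B q => LinearEquiv.refl k (HochschildChains k B.carrier q)) (fun _ _ _ => rfl)
    (fun B x => hochschildComplex_d_one_zero k B x)
    (cyclicBicomplex_d_one_zero k)

/-- The low degrees of the complex `CC^{2}(B)`. -/
def cyclicLowDegreeChains₂ : LowDegreeChains (cyclicComplex₂.{u, v} k) :=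
  LowDegreeChains.total (cyclicBicomplex₂ k)
    (fun B q => LinearEquiv.refl k (HochschildChains k B.carrier q)) (fun _ _ _ => rfl)
    (fun B x => hochschildComplex_d_one_zero k B x)
    (cyclicBicomplex₂_d_one_zero k)

theorem cyclicLowDegreeChains_incl₀ (B : NonUnitalAlgCat.{u, v} k) (b : B.carrier) :
    (cyclicLowDegreeChains k).incl₀ B b = cyclicZeroChain B b :=
  congrArg (totalIncl ((cyclicBicomplex k).obj B) 0 0 0 rfl) (zeroChains_apply k b)

theorem cyclicLowDegreeChains₂_incl₀ (B : NonUnitalAlgCat.{u, v} k) (b : B.carrier) :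
    (cyclicLowDegreeChains₂ k).incl₀ B b = hochschildZeroChain B b :=
  congrArg (totalIncl ((cyclicBicomplex₂ k).obj B) 0 0 0 rfl) (zeroChains_apply k b)

end LowDegreeInstances

end

end AlgHomology

/-! ### The two exact sequences and degree 0 -/

theorem theorem3p3 {k : Type u} [Field k] {R A : Type v}
    [NonUnitalRing R] [Module k R] [IsScalarTower k R R] [SMulCommClass k R R]
    [NonUnitalRing A] [Module k A] [IsScalarTower k A A] [SMulCommClass k A A]
    (X : AlgCrossedModule k R A) :
    (∃ (δ : HH k X.Coker 2 →ₗ[k] X.ker ⧸ X.kerCommutator)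
        (β : (X.ker ⧸ X.kerCommutator) →ₗ[k] X.HH 1),
      (∀ x : X.ker, X.IsHHClass (X.oneSimplex x) (β (Submodule.Quotient.mk x))) ∧
      Function.Exact (X.HHToCoker 2) δ ∧ Function.Exact δ β ∧
      Function.Exact β (X.HHToCoker 1) ∧ Function.Surjective (X.HHToCoker 1)) ∧
    (∃ (δ : HC k X.Coker 2 →ₗ[k] X.ker ⧸ X.kerCommutator)
        (β : (X.ker ⧸ X.kerCommutator) →ₗ[k] X.HC 1),
      (∀ x : X.ker, X.IsHCClass (X.oneSimplex x) (β (Submodule.Quotient.mk x))) ∧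
      Function.Exact (X.HCToCoker 2) δ ∧ Function.Exact δ β ∧
      Function.Exact β (X.HCToCoker 1) ∧ Function.Surjective (X.HCToCoker 1)) ∧
    (∃ e : X.HH 0 ≃ₗ[k] X.Coker ⧸ commutatorSubspace k X.Coker,
      ∀ a : A, X.IsHHClass (X.zeroSimplex a) (e.symm (Submodule.Quotient.mk (AlgCrossedModule.Coker.mk X a)))) ∧
    (∃ e : X.HC 0 ≃ₗ[k] X.Coker ⧸ commutatorSubspace k X.Coker,
      ∀ a : A, X.IsHCClass (X.zeroSimplex a) (e.symm (Submodule.Quotient.mk (AlgCrossedModule.Coker.mk X a)))) := by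
  refine ⟨?_, ?_, ?_, ?_⟩
  · obtain ⟨δ, β, h, h'⟩ := X.exists_exact_sequence_toCoker (cyclicLowDegreeChains₂ k)
      X.rowExact_cyclicComplex₂
    -- The general result names the cycle through `incl₀`, which agrees with the chain at the (0, 0)
    -- spot used in the statement. The other three parts are translated in the same way.
    exact ⟨δ, β, fun x => (congrArg (fun c => IsHomologyClass _ 1
      (X.rowZeroChain (cyclicComplex₂ k) 1 c) (β (Submodule.Quotient.mk x)))
      (cyclicLowDegreeChains₂_incl₀ k ⟨X.NerveObj 1⟩ (X.oneSimplex x))).mp (h x), h'⟩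
  · obtain ⟨δ, β, h, h'⟩ := X.exists_exact_sequence_toCoker (cyclicLowDegreeChains k)
      X.rowExact_cyclicComplex
    exact ⟨δ, β, fun x => (congrArg (fun c => IsHomologyClass _ 1
      (X.rowZeroChain (cyclicComplex k) 1 c) (β (Submodule.Quotient.mk x)))
      (cyclicLowDegreeChains_incl₀ k ⟨X.NerveObj 1⟩ (X.oneSimplex x))).mp (h x), h'⟩
  · obtain ⟨e, h⟩ := X.exists_homology_zero_equiv_coker (cyclicLowDegreeChains₂ k)
    exact ⟨e, fun a => (congrArg (fun c => IsHomologyClass _ 0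
      (X.rowZeroChain (cyclicComplex₂ k) 0 c) (e.symm (Submodule.Quotient.mk _)))
      (cyclicLowDegreeChains₂_incl₀ k ⟨X.NerveObj 0⟩ (X.zeroSimplex a))).mp (h a)⟩
  · obtain ⟨e, h⟩ := X.exists_homology_zero_equiv_coker (cyclicLowDegreeChains k)
    exact ⟨e, fun a => (congrArg (fun c => IsHomologyClass _ 0
      (X.rowZeroChain (cyclicComplex k) 0 c) (e.symm (Submodule.Quotient.mk _)))
      (cyclicLowDegreeChains_incl₀ k ⟨X.NerveObj 0⟩ (X.zeroSimplex a))).mp (h a)⟩
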